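/- Let $S=(S_t)_{t\ge 0}$ be a subordinator (a real Lévy process with values in $[0,\infty)$) with Laplace exponent $\phi(\lambda)=-\log \mathbb{E}\,e^{-\lambda S_1}$, $\lambda>0$, and Lévy measure $\mu$ on $(0,\infty)$, i.e. $\int_{(0,\infty)}(1\wedge t)\,\mu(dt)<\infty$ and, for some $\gamma\ge 0$, $\mathbb{E}\,e^{-\lambda S_t}=e^{-t\phi(\lambda)}$ with $\phi(\lambda)=\gamma\lambda+\int_{(0,\infty)}(1-e^{-\lambda u})\,\mu(du)$ for all $t\ge 0$, $\lambda>0$. Let $d\ge 3$, let $B$ be a Brownian motion in $\mathbb{R}^d$ with $B_0=0$ and transition density $(4\pi t)^{-d/2}e^{-|x-y|^2/(4t)}$, independent of $S$, and let $X_t=B(S_t)$ be the subordinate Brownian motion. Put \[ j(r)=\int_{(0,\infty)}(4\pi t)^{-d/2}e^{-r^2/(4t)}\,\mu(dt),\qquad r>0 . \] A function $f$ that is positive on $(0,\infty)$ is said to vary regularly at infinity with index $\rho\in\mathbb{R}$ if $\lim_{\lambda\to\infty}f(\lambda x)/f(\lambda)=x^\rho$ for every $x>0$, and $f(r)\asymp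 g(r)$ as $r\to 0+$ means that there are constants $c_1,c_2>0$ with $c_1\le f(r)/g(r)\le c_2$ for all sufficiently small $r>0$. Assume that (A-1) $\phi'$ varies regularly at infinity with index $\frac{\alpha}{2}-1$ for some $\alpha\in[0,2]$; (A-2) $\mu$ is an infinite measure and has a decreasing (that is, non-increasing) density with respect to Lebesgue measure on $(0,\infty)$. Then the Lévy measure of $X$ is $j(|x|)\,dx$, and the following hold. (i) If $\alpha\in[0,2)$, then \[ j(r)\asymp r^{-d-2}\,\phi'(r^{-2}),\qquad r\to 0+ . \] (ii) If $\alpha=2$ and, in addition, (A-4) $\lambda\mapsto\left(\frac{\lambda}{\phi(\lambda)}\right)'$ varies regularly at infinity with index $-1$, then \[ j(r)\asymp r^{-d-2}\left(r^2\phi(r^{-2})-\phi'(r^{-2})\right),\qquad r\to 0+ . \] -/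

import Mathlib

open MeasureTheory ProbabilityTheory Filter Topology Set
open scoped NNReal ENNReal RealInnerProductSpace

noncomputable section

/-- A Lévy process: measurable coordinates, independent and stationary increments, almost surely
right continuous paths with left limits, started almost surely at the origin. -/
structure IsLevyProcess {Ω E : Type*} [MeasurableSpace Ω] [NormedAddCommGroup E]
    [MeasurableSpace E] (X : ℝ≥0 → Ω → E) (P : Measure Ω) : Prop where
  measurable : ∀ t, Measurable (X t)
  indepIncrements : HasIndepIncrements X P
  stationary : ∀ s h, IdentDistrib (fun ω => X (s + h) ω - X s ω) (X h) P P
  cadlag : ∀ᵐ ω ∂P, ∀ t, ContinuousWithinAt (fun s => X s ω) (Ici t) t ∧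
    ∃ l, Tendsto (fun s => X s ω) (𝓝[<] t) (𝓝 l)
  zero : ∀ᵐ ω ∂P, X 0 ω = 0

/-- A subordinator: a real Lévy process with values in `[0, ∞)`. -/
structure IsSubordinator {Ω : Type*} [MeasurableSpace Ω] (S : ℝ≥0 → Ω → ℝ) (P : Measure Ω) :
    Prop extends IsLevyProcess S P where
  nonneg : ∀ t, ∀ᵐ ω ∂P, 0 ≤ S t ω

/-- The Laplace exponent `φ(l) = -log E[exp(-l S₁)]` (of interest for `l > 0`). -/
def laplaceExponent {Ω : Type*} [MeasurableSpace Ω] (S : ℝ≥0 → Ω → ℝ) (P : Measure Ω)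
    (l : ℝ) : ℝ :=
  -Real.log (∫ ω, Real.exp (-l * S 1 ω) ∂P)

/-- `ν` is the Lévy measure of the subordinator `S`: it is a measure on `(0, ∞)` with
`∫ (1 ∧ t) ν(dt) < ∞`, and for some drift `γ ≥ 0`,
`E[exp(-l Sₜ)] = exp(-t (γ l + ∫ (1 - exp(-l u)) ν(du)))` for all `t ≥ 0` and `l > 0`. -/
def IsSubordinatorLevyMeasure {Ω : Type*} [MeasurableSpace Ω] (S : ℝ≥0 → Ω → ℝ)
    (P : Measure Ω) (ν : Measure ℝ) : Prop :=
  ν (Iic 0) = 0 ∧ ∫⁻ u, ENNReal.ofReal (min 1 u) ∂ν < ∞ ∧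
    ∃ γ : ℝ, 0 ≤ γ ∧ ∀ (t : ℝ≥0) (l : ℝ), 0 < l →
      ∫ ω, Real.exp (-l * S t ω) ∂P
        = Real.exp (-(t : ℝ) * (γ * l + ∫ u in Ioi (0 : ℝ), (1 - Real.exp (-l * u)) ∂ν))

/-- The measure `ν` has a decreasing density with respect to Lebesgue measure on `(0, ∞)`. -/
def HasDecreasingDensity (ν : Measure ℝ) : Prop :=
  ∃ m : ℝ → ℝ≥0, AntitoneOn m (Ioi 0) ∧
    ν = (volume.restrict (Ioi 0)).withDensity (fun t => (m t : ℝ≥0∞))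

/-- `f`, positive on `(0, ∞)`, varies regularly at infinity with index `ρ`. -/
def RegularlyVarying (f : ℝ → ℝ) (ρ : ℝ) : Prop :=
  (∀ l, 0 < l → 0 < f l) ∧
    ∀ x, 0 < x → Tendsto (fun l => f (l * x) / f l) atTop (𝓝 (x ^ ρ))

/-- `f(r) ≍ g(r)` as `r → 0+`: the quotient `f/g` stays between two positive constants. -/
def ComparableAtZero (f g : ℝ → ℝ) : Prop :=
  ∃ c₁ c₂ : ℝ, 0 < c₁ ∧ 0 < c₂ ∧ ∀ᶠ r in 𝓝[>] (0 : ℝ), c₁ ≤ f r / g r ∧ f r / g r ≤ c₂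

/-- The radial heat kernel `(4πt)^{-d/2} exp(-r²/(4t))`. -/
def heatKernel (d : ℕ) (t r : ℝ) : ℝ :=
  (4 * Real.pi * t) ^ (-((d : ℝ) / 2)) * Real.exp (-(r ^ 2) / (4 * t))

/-- Brownian motion in `ℝᵈ` started at the origin, normalised to have transition density
`(4πt)^{-d/2} exp(-|x-y|²/(4t))` (characteristic exponent `|ξ|²`). -/
structure IsBrownianMotion {Ω : Type*} [MeasurableSpace Ω] {d : ℕ}
    (B : ℝ≥0 → Ω → EuclideanSpace ℝ (Fin d)) (P : Measure Ω) : Prop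
    extends IsLevyProcess B P where
  continuous_paths : ∀ᵐ ω ∂P, Continuous (fun t => B t ω)
  law : ∀ t : ℝ≥0, 0 < t →
    P.map (B t) = volume.withDensity (fun x => ENNReal.ofReal (heatKernel d t ‖x‖))

/-- The subordinate process `Xₜ = B(Sₜ)`. -/
def subordinate {Ω E : Type*} (B : ℝ≥0 → Ω → E) (S : ℝ≥0 → Ω → ℝ) : ℝ≥0 → Ω → E :=
  fun t ω => B (S t ω).toNNReal ω

/-- `Π` is the Lévy measure of the `ℝᵈ`-valued process `X`: `Π {0} = 0`,
`∫ (1 ∧ |x|²) Π(dx) < ∞`, and for some vector `b` and some non-negative definite symmetric `A`,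
`E[exp(i⟨ξ, Xₜ⟩)] = exp(-t Φ(ξ))` for all `t ≥ 0` and `ξ`, where
`Φ(ξ) = i⟨b, ξ⟩ + ⟨Aξ, ξ⟩ / 2 + ∫ (1 - exp(i⟨x, ξ⟩) + i⟨x, ξ⟩ 1_{|x| ≤ 1}) Π(dx)`. -/
def IsLevyMeasureOf {Ω : Type*} [MeasurableSpace Ω] {d : ℕ}
    (X : ℝ≥0 → Ω → EuclideanSpace ℝ (Fin d)) (P : Measure Ω)
    (Pi : Measure (EuclideanSpace ℝ (Fin d))) : Prop :=
  Pi {0} = 0 ∧ ∫⁻ x, ENNReal.ofReal (min 1 (‖x‖ ^ 2)) ∂Pi < ∞ ∧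
    ∃ (b : EuclideanSpace ℝ (Fin d))
      (A : EuclideanSpace ℝ (Fin d) →L[ℝ] EuclideanSpace ℝ (Fin d)), A.IsPositive ∧
      ∀ (t : ℝ≥0) (ξ : EuclideanSpace ℝ (Fin d)),
        ∫ ω, Complex.exp (Complex.I * ((⟪ξ, X t ω⟫ : ℝ) : ℂ)) ∂P
          = Complex.exp (-(((t : ℝ≥0) : ℝ) : ℂ) *
              (Complex.I * ((⟪b, ξ⟫ : ℝ) : ℂ) + (1 / 2 : ℂ) * ((⟪A ξ, ξ⟫ : ℝ) : ℂ) +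
                ∫ x, (1 - Complex.exp (Complex.I * ((⟪x, ξ⟫ : ℝ) : ℂ)) +
                  (if ‖x‖ ≤ 1 then Complex.I * ((⟪x, ξ⟫ : ℝ) : ℂ) else 0)) ∂Pi))

/-- The function `j(r) = ∫_{(0,∞)} (4πt)^{-d/2} exp(-r²/(4t)) ν(dt)`, `r > 0`, where `ν` is the
Lévy measure of the subordinator. -/
def radialLevyDensity (d : ℕ) (ν : Measure ℝ) (r : ℝ) : ℝ :=
  ∫ t in Ioi (0 : ℝ), heatKernel d t r ∂ν

/-- The measure `j(|x|) dx` on `ℝᵈ`. -/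
def radialMeasure (d : ℕ) (j : ℝ → ℝ) : Measure (EuclideanSpace ℝ (Fin d)) :=
  volume.withDensity (fun x => ENNReal.ofReal (j ‖x‖))

end

/-!
The radial density `j` is a mixture over `t` of heat kernels, and after the substitution `t = r² s`
the heat kernel concentrates on times `t` of order `r²`. Hence `j(r)` should be comparable to
`r ^ (2 - d) m(r²)`, where `m` is the decreasing density of `ν`, and everything rests on comparing
`m` with the Laplace exponent `φ`. Both comparison functions have the form `Ψ(l) = a l + ∫ h(l u)
ν(du)` (`scaledTransform`): `l φ'(l)` with `a` the drift and `h(v) = v exp(-v)`, and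
`φ(l) - l φ'(l)` with `a = 0` and `h(v) = 1 - (1 + v) exp(-v)`. The claim becomes
`j(r) ≍ r ^ (-d) Ψ(r⁻²)` in both cases.

Upper bound (`radialLevyDensity_le`). As `m` decreases and `h` is bounded below on `[1/2, 1]`,
`m(t) ≤ C t⁻¹ Ψ(1/t)` (`density_le_scaledTransform`). Moreover `Ψ(x l) ≤ D x² Ψ(l)` for `x ≥ 1`, so
`m(r² s) ≤ C r⁻² Ψ(r⁻²) (1 + s⁻³)`, and `(1 + s⁻³)` times the heat kernel is integrable in `s`
because `d ≥ 3`. Regular variation plays no role here.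

Lower bound (`le_radialLevyDensity`). Split the integral in `Ψ(l)` at `u = δ / l` and `u = M / l`.
The outer parts are at most `K₁ Ψ(x l)` and `K₂ Ψ(y l)` for suitable `x`, `y`, the middle one at most
`m(δ / l) M / l` (`scaledTransform_le`). If `Ψ` varies regularly with index `ρ`, the outer parts
amount to the fraction `K₁ x ^ ρ + K₂ y ^ ρ` of `Ψ(l)` in the limit, which is less than one for small
`δ` and large `M`; so `m(δ / l)` is at least a multiple of `l Ψ(l)`. This elementary splitting
replaces the Tauberian theorem. For `h(v) = v exp(-v)` it needs `ρ < 1`, that is, `α < 2`; the other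
kernel behaves like `v²` at zero and allows `ρ = 1`. In the latter case the regular variation of `Ψ`
comes from `Ψ = (l / φ)' φ²` and from `tendsto_div_of_deriv_slowlyVarying`, which makes `φ`
regularly varying of index one.

Lévy measure. Conditioning on `S` gives `E exp(i⟨ξ, Xₜ⟩) = E exp(-|ξ|² Sₜ) = exp(-t φ(|ξ|²))`
(`integral_cexp_inner_subordinate`; the conditioning is done for random times with values in a grid
and passes to the limit by path continuity). Fubini and the Gaussian characteristic function identify
the jump part of `φ(|ξ|²)` with the Lévy–Khintchine integral of `j(|x|) dx`; the compensator
integrates to zero by symmetry.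
-/

/-! ### Measures on the half-line with a decreasing density -/

section HalfLine

variable {ν : Measure ℝ}

lemma ae_pos_of_measure_Iic_zero (h0 : ν (Iic 0) = 0) : ∀ᵐ u ∂ν, 0 < u := by
  rw [ae_iff]
  simp only [not_lt]
  exact h0

lemma restrict_Ioi_zero_eq_self (h0 : ν (Iic 0) = 0) : ν.restrict (Ioi 0) = ν :=
  Measure.restrict_eq_self_of_ae_mem (ae_pos_of_measure_Iic_zero h0)

lemma integrable_min_one (h0 : ν (Iic 0) = 0)
    (hfin : ∫⁻ u, ENNReal.ofReal (min 1 u) ∂ν < ∞) : Integrable (fun u => min 1 u) ν := by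
  refine ⟨by fun_prop, ?_⟩
  rw [hasFiniteIntegral_iff_ofReal]
  · exact hfin
  · filter_upwards [ae_pos_of_measure_Iic_zero h0] with u hu
    simp [hu.le]

lemma integrable_of_norm_le_min {E : Type*} [NormedAddCommGroup E] (h0 : ν (Iic 0) = 0)
    (hfin : ∫⁻ u, ENNReal.ofReal (min 1 u) ∂ν < ∞) {f : ℝ → E}
    (hf : AEStronglyMeasurable f ν) {C : ℝ} (hC : ∀ u, 0 < u → ‖f u‖ ≤ C * min 1 u) :
    Integrable f ν := by
  refine ((integrable_min_one h0 hfin).const_mul C).mono' hf ?_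
  filter_upwards [ae_pos_of_measure_Iic_zero h0] with u hu using hC u hu

variable {m : ℝ → ℝ≥0}

lemma measure_Iic_zero_withDensity :
    ((volume.restrict (Ioi 0)).withDensity (fun t => (m t : ℝ≥0∞))) (Iic 0) = 0 := by
  refine withDensity_absolutelyContinuous _ _ ?_
  rw [Measure.restrict_apply measurableSet_Iic, Iic_inter_Ioi, Ioc_self, measure_empty]

lemma measureReal_Ioc_le (hm : AntitoneOn m (Ioi 0)) {a b : ℝ} (ha : 0 < a) (hab : a ≤ b) :
    ((volume.restrict (Ioi 0)).withDensity (fun t => (m t : ℝ≥0∞))).real (Ioc a b)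
      ≤ m a * (b - a) := by
  rw [Measure.real]
  have hs : Ioc a b ∩ Ioi 0 = Ioc a b := inter_eq_left.2 fun u hu => ha.trans hu.1
  refine ENNReal.toReal_le_of_le_ofReal (by have := sub_nonneg.2 hab; positivity) ?_
  rw [withDensity_apply _ measurableSet_Ioc, Measure.restrict_restrict measurableSet_Ioc, hs]
  calc ∫⁻ u in Ioc a b, (m u : ℝ≥0∞) ≤ ∫⁻ _ in Ioc a b, (m a : ℝ≥0∞) := by
        refine setLIntegral_mono measurable_const fun u hu => ?_
        exact_mod_cast hm ha (ha.trans hu.1) hu.1.le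
    _ = ENNReal.ofReal (m a * (b - a)) := by
        rw [setLIntegral_const, Real.volume_Ioc, ENNReal.ofReal_mul (by positivity)]
        simp

lemma withDensity_Ioc_lt_top (hm : AntitoneOn m (Ioi 0)) {a b : ℝ} (ha : 0 < a) :
    ((volume.restrict (Ioi 0)).withDensity (fun t => (m t : ℝ≥0∞))) (Ioc a b) < ∞ := by
  have hs : Ioc a b ∩ Ioi 0 = Ioc a b := inter_eq_left.2 fun u hu => ha.trans hu.1
  rw [withDensity_apply _ measurableSet_Ioc, Measure.restrict_restrict measurableSet_Ioc, hs]
  calc ∫⁻ u in Ioc a b, (m u : ℝ≥0∞) ≤ ∫⁻ _ in Ioc a b, (m a : ℝ≥0∞) := by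
        refine setLIntegral_mono measurable_const fun u hu => ?_
        exact_mod_cast hm ha (ha.trans hu.1) hu.1.le
    _ < ∞ := by
        rw [setLIntegral_const, Real.volume_Ioc]
        exact ENNReal.mul_lt_top ENNReal.coe_lt_top ENNReal.ofReal_lt_top

lemma le_measureReal_Ioc (hm : AntitoneOn m (Ioi 0)) {a b : ℝ} (ha : 0 < a) (hab : a ≤ b) :
    m b * (b - a)
      ≤ ((volume.restrict (Ioi 0)).withDensity (fun t => (m t : ℝ≥0∞))).real (Ioc a b) := by
  rw [Measure.real]
  refine (ENNReal.ofReal_le_iff_le_toReal (withDensity_Ioc_lt_top hm ha).ne).1 ?_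
  have hs : Ioc a b ∩ Ioi 0 = Ioc a b := inter_eq_left.2 fun u hu => ha.trans hu.1
  rw [withDensity_apply _ measurableSet_Ioc, Measure.restrict_restrict measurableSet_Ioc, hs]
  calc ENNReal.ofReal (m b * (b - a)) = ∫⁻ _ in Ioc a b, (m b : ℝ≥0∞) := by
        rw [setLIntegral_const, Real.volume_Ioc, ENNReal.ofReal_mul (by positivity)]
        simp
    _ ≤ ∫⁻ u in Ioc a b, (m u : ℝ≥0∞) := by
        refine setLIntegral_mono' measurableSet_Ioc fun u hu => ?_
        exact_mod_cast hm (mem_Ioi.2 (ha.trans hu.1)) (mem_Ioi.2 (ha.trans_le hab)) hu.2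

lemma integral_withDensity_Ioi (hm : AntitoneOn m (Ioi 0)) (f : ℝ → ℝ) :
    ∫ t, f t ∂((volume.restrict (Ioi 0)).withDensity (fun t => (m t : ℝ≥0∞)))
      = ∫ t in Ioi 0, m t * f t := by
  rw [integral_withDensity_eq_integral_smul₀
    (aemeasurable_restrict_of_antitoneOn measurableSet_Ioi hm)]
  simp only [NNReal.smul_def, smul_eq_mul]

end HalfLine

/-! ### The radial heat kernel -/

section HeatKernel

lemma heatKernel_nonneg (d : ℕ) {t : ℝ} (ht : 0 < t) (r : ℝ) : 0 ≤ heatKernel d t r := by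
  unfold heatKernel; positivity

lemma measurable_heatKernel (d : ℕ) : Measurable (fun p : ℝ × ℝ => heatKernel d p.1 p.2) := by
  unfold heatKernel; fun_prop

lemma heatKernel_scale (d : ℕ) {r s : ℝ} (hr : 0 < r) (hs : 0 < s) :
    heatKernel d (r ^ 2 * s) r = r ^ (-(d : ℝ)) * heatKernel d s 1 := by
  unfold heatKernel
  have h1 : 4 * Real.pi * (r ^ 2 * s) = r ^ 2 * (4 * Real.pi * s) := by ring
  have h2 : (r ^ 2) ^ (-((d : ℝ) / 2)) = r ^ (-(d : ℝ)) := by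
    rw [← Real.rpow_natCast, ← Real.rpow_mul hr.le]; congr 1; push_cast; ring
  have h3 : -(r ^ 2) / (4 * (r ^ 2 * s)) = -(1 ^ 2) / (4 * s) := by field_simp
  rw [h1, Real.mul_rpow (by positivity) (by positivity), h2, h3, mul_assoc]

/-- The exponential factor of the heat kernel beats every power of the time. -/
lemma exp_neg_inv_le (n : ℕ) {t r : ℝ} (ht : 0 < t) (hr : 0 < r) :
    Real.exp (-(r ^ 2) / (4 * t)) ≤ n.factorial * (4 * t / r ^ 2) ^ n := by
  have h := Real.pow_div_factorial_le_exp (r ^ 2 / (4 * t)) (by positivity) n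
  have e : -(r ^ 2) / (4 * t) = -(r ^ 2 / (4 * t)) := by ring
  rw [e, Real.exp_neg, inv_le_comm₀ (Real.exp_pos _) (by positivity)]
  refine le_trans (le_of_eq ?_) h
  rw [div_pow, div_pow]
  field_simp

/-- Away from the origin the heat kernel is `O(1 ∧ t ^ k)` for every `k`. -/
lemma heatKernel_le_pow (d k : ℕ) {r : ℝ} (hr : 0 < r) :
    ∃ C, 0 ≤ C ∧ ∀ t, 0 < t → t ≤ 1 → heatKernel d t r ≤ C * t ^ k := by
  refine ⟨(4 * Real.pi) ^ (-((d : ℝ) / 2)) * ((d + k).factorial * (4 / r ^ 2) ^ (d + k)),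
    by positivity, fun t ht ht1 => ?_⟩
  -- Of the `d + k` powers of `t` gained, `d` more than absorb the factor `t ^ (-d / 2)`.
  have h := exp_neg_inv_le (d + k) ht hr
  have h2 : t ^ (-((d : ℝ) / 2)) * t ^ d ≤ 1 := by
    rw [← Real.rpow_natCast, ← Real.rpow_add ht]
    refine Real.rpow_le_one ht.le ht1 ?_
    have : (0 : ℝ) ≤ d := by positivity
    linarith
  unfold heatKernel
  rw [Real.mul_rpow (by positivity) ht.le]
  calc (4 * Real.pi) ^ (-((d : ℝ) / 2)) * t ^ (-((d : ℝ) / 2)) * Real.exp (-(r ^ 2) / (4 * t))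
      ≤ (4 * Real.pi) ^ (-((d : ℝ) / 2)) * t ^ (-((d : ℝ) / 2)) *
          ((d + k).factorial * (4 * t / r ^ 2) ^ (d + k)) := by gcongr
    _ = (4 * Real.pi) ^ (-((d : ℝ) / 2)) * ((d + k).factorial * (4 / r ^ 2) ^ (d + k)) * t ^ k
          * (t ^ (-((d : ℝ) / 2)) * t ^ d) := by
        have : 4 * t / r ^ 2 = 4 / r ^ 2 * t := by ring
        rw [this, mul_pow, pow_add t]; ring
    _ ≤ (4 * Real.pi) ^ (-((d : ℝ) / 2)) * ((d + k).factorial * (4 / r ^ 2) ^ (d + k)) * t ^ k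
          * 1 := by gcongr
    _ = _ := by ring

lemma heatKernel_le_rpow (d : ℕ) {t : ℝ} (ht : 0 < t) (r : ℝ) :
    heatKernel d t r ≤ (4 * Real.pi) ^ (-((d : ℝ) / 2)) * t ^ (-((d : ℝ) / 2)) := by
  unfold heatKernel
  rw [Real.mul_rpow (by positivity) ht.le]
  refine mul_le_of_le_one_right (by positivity) (Real.exp_le_one_iff.2 ?_)
  exact div_nonpos_of_nonpos_of_nonneg (by nlinarith [sq_nonneg r]) (by positivity)

lemma heatKernel_le_min (d : ℕ) {r : ℝ} (hr : 0 < r) :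
    ∃ C, ∀ t, 0 < t → heatKernel d t r ≤ C * min 1 t := by
  obtain ⟨C, hC0, hC⟩ := heatKernel_le_pow d 1 hr
  refine ⟨max C ((4 * Real.pi) ^ (-((d : ℝ) / 2))), fun t ht => ?_⟩
  rcases le_total t 1 with h | h
  · rw [min_eq_right h]
    refine (hC t ht h).trans ?_
    rw [pow_one]; gcongr; exact le_max_left _ _
  · rw [min_eq_left h, mul_one]
    refine (heatKernel_le_rpow d ht r).trans (le_trans ?_ (le_max_right _ _))
    refine mul_le_of_le_one_right (by positivity) ?_
    exact Real.rpow_le_one_of_one_le_of_nonpos h (by simp; positivity)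

lemma integrable_heatKernel {ν : Measure ℝ} (h0 : ν (Iic 0) = 0)
    (hfin : ∫⁻ u, ENNReal.ofReal (min 1 u) ∂ν < ∞) (d : ℕ) {r : ℝ} (hr : 0 < r) :
    Integrable (fun t => heatKernel d t r) ν := by
  obtain ⟨C, hC⟩ := heatKernel_le_min d hr
  refine integrable_of_norm_le_min (C := C) h0 hfin ?_ fun t ht => ?_
  · exact ((measurable_heatKernel d).comp (by fun_prop :
      Measurable fun t : ℝ => (t, r))).aestronglyMeasurable
  · rw [Real.norm_of_nonneg (heatKernel_nonneg d ht r)]; exact hC t ht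

/-- The dimension restriction `d ≥ 3` enters here: the heat kernel is integrable in time near
infinity. -/
lemma integrableOn_heatKernel_weight {d : ℕ} (hd : 3 ≤ d) :
    IntegrableOn (fun s => (1 + s⁻¹ ^ 3) * heatKernel d s 1) (Ioi 0) := by
  have hmeas : Measurable (fun s : ℝ => (1 + s⁻¹ ^ 3) * heatKernel d s 1) :=
    (by fun_prop : Measurable fun s : ℝ => 1 + s⁻¹ ^ 3).mul
      ((measurable_heatKernel d).comp (by fun_prop : Measurable fun t : ℝ => (t, (1 : ℝ))))
  obtain ⟨C, hC0, hC⟩ := heatKernel_le_pow d 3 one_pos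
  rw [← Ioc_union_Ioi_eq_Ioi zero_le_one]
  refine IntegrableOn.union ?_ ?_
  · refine Measure.integrableOn_of_bounded (M := 2 * C) (by simp) hmeas.aestronglyMeasurable ?_
    filter_upwards [ae_restrict_mem measurableSet_Ioc] with s hs
    have h1 := hC s hs.1 hs.2
    have h2 : s ^ 3 ≤ 1 := pow_le_one₀ hs.1.le hs.2
    have h3 := pow_pos hs.1 3
    rw [Real.norm_of_nonneg (mul_nonneg (by have := hs.1; positivity)
      (heatKernel_nonneg d hs.1 1))]
    calc (1 + s⁻¹ ^ 3) * heatKernel d s 1 ≤ (1 + s⁻¹ ^ 3) * (C * s ^ 3) := by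
          have := hs.1; gcongr
      _ = C * s ^ 3 + C := by have := hs.1.ne'; field_simp
      _ ≤ 2 * C := by nlinarith
  · have hd' : (3 : ℝ) ≤ d := by exact_mod_cast hd
    have hint := (integrableOn_Ioi_rpow_of_lt (a := -((d : ℝ) / 2)) (by linarith)
      zero_lt_one).const_mul (2 * (4 * Real.pi) ^ (-((d : ℝ) / 2)))
    refine Integrable.mono' hint hmeas.aestronglyMeasurable ?_
    filter_upwards [ae_restrict_mem measurableSet_Ioi] with s hs
    have hs1 : (1 : ℝ) < s := hs
    have hs0 : 0 < s := zero_lt_one.trans hs1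
    rw [Real.norm_of_nonneg (mul_nonneg (by positivity) (heatKernel_nonneg d hs0 1))]
    have h2 : s⁻¹ ^ 3 ≤ 1 := pow_le_one₀ (by positivity) (inv_le_one_of_one_le₀ hs1.le)
    calc (1 + s⁻¹ ^ 3) * heatKernel d s 1
        ≤ 2 * ((4 * Real.pi) ^ (-((d : ℝ) / 2)) * s ^ (-((d : ℝ) / 2))) := by
          refine mul_le_mul (by linarith) (heatKernel_le_rpow d hs0 1)
            (heatKernel_nonneg d hs0 1) (by norm_num)
      _ = _ := by ring

end HeatKernel

/-! ### Two-sided bounds for the radial density -/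

section ScaledTransform

/-- The function `a l + ∫ h(l u) ν(du)`. Both comparison functions `l φ'(l)` and `φ(l) - l φ'(l)`
are of this form. -/
noncomputable def scaledTransform (ν : Measure ℝ) (a : ℝ) (h : ℝ → ℝ) (l : ℝ) : ℝ :=
  a * l + ∫ u, h (l * u) ∂ν

variable {ν : Measure ℝ} {a : ℝ} {h : ℝ → ℝ}

lemma integrable_comp_mul (h0 : ν (Iic 0) = 0)
    (hfin : ∫⁻ u, ENNReal.ofReal (min 1 u) ∂ν < ∞) (hmeas : Measurable h)
    (hn : ∀ v, 0 < v → 0 ≤ h v) (hh : ∀ v, 0 < v → h v ≤ min 1 v) {l : ℝ} (hl : 0 < l) :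
    Integrable (fun u => h (l * u)) ν := by
  refine integrable_of_norm_le_min (C := max 1 l) h0 hfin
    (hmeas.comp (measurable_const_mul l)).aestronglyMeasurable fun u hu => ?_
  rw [Real.norm_of_nonneg (hn _ (mul_pos hl hu))]
  refine (hh _ (mul_pos hl hu)).trans ?_
  rw [mul_min_of_nonneg _ _ (by positivity), mul_one]
  exact min_le_min (le_max_left _ _) (by gcongr; exact le_max_right _ _)

/-- The density of `ν` is dominated by the transform, because it is decreasing and `h` is bounded
below on `[1/2, 1]`. -/
lemma density_le_scaledTransform {m : ℝ → ℝ≥0} (hm : AntitoneOn m (Ioi 0))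
    (hν : ν = (volume.restrict (Ioi 0)).withDensity (fun t => (m t : ℝ≥0∞)))
    (hfin : ∫⁻ u, ENNReal.ofReal (min 1 u) ∂ν < ∞) (hmeas : Measurable h)
    (hn : ∀ v, 0 < v → 0 ≤ h v) (hh : ∀ v, 0 < v → h v ≤ min 1 v) (ha : 0 ≤ a)
    {c : ℝ} (hc : 0 < c) (hlow : ∀ v, 1 / 2 ≤ v → v ≤ 1 → c ≤ h v) {t : ℝ} (ht : 0 < t) :
    (m t : ℝ) ≤ 2 / c * (t⁻¹ * scaledTransform ν a h t⁻¹) := by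
  have h0 : ν (Iic 0) = 0 := hν ▸ measure_Iic_zero_withDensity
  have hint := integrable_comp_mul h0 hfin hmeas hn hh (inv_pos.2 ht)
  have hfinI : ν (Ioc (t / 2) t) < ∞ := hν ▸ withDensity_Ioc_lt_top hm (half_pos ht)
  have h1 : m t * (t - t / 2) ≤ ν.real (Ioc (t / 2) t) :=
    hν ▸ le_measureReal_Ioc hm (half_pos ht) (by linarith)
  have h2 : c * ν.real (Ioc (t / 2) t) ≤ ∫ u in Ioc (t / 2) t, h (t⁻¹ * u) ∂ν := by
    rw [mul_comm, ← smul_eq_mul, ← setIntegral_const]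
    refine setIntegral_mono_on (integrableOn_const hfinI.ne) hint.integrableOn
      measurableSet_Ioc fun u hu => ?_
    refine hlow _ ?_ ?_
    · rw [inv_mul_eq_div, le_div_iff₀ ht]; linarith [hu.1]
    · rw [inv_mul_eq_div, div_le_one ht]; exact hu.2
  have h3 : ∫ u in Ioc (t / 2) t, h (t⁻¹ * u) ∂ν ≤ ∫ u, h (t⁻¹ * u) ∂ν := by
    refine setIntegral_le_integral hint ?_
    filter_upwards [ae_pos_of_measure_Iic_zero h0] with u hu
      using hn _ (mul_pos (inv_pos.2 ht) hu)
  have h4 : c * (m t * t) ≤ 2 * scaledTransform ν a h t⁻¹ := by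
    have : 0 ≤ a * t⁻¹ := by positivity
    unfold scaledTransform
    nlinarith
  calc (m t : ℝ) = 1 / c * t⁻¹ * (c * (m t * t)) := by field_simp
    _ ≤ 1 / c * t⁻¹ * (2 * scaledTransform ν a h t⁻¹) := by gcongr
    _ = _ := by ring

lemma scaledTransform_mul_le (h0 : ν (Iic 0) = 0)
    (hfin : ∫⁻ u, ENNReal.ofReal (min 1 u) ∂ν < ∞) (hmeas : Measurable h)
    (hn : ∀ v, 0 < v → 0 ≤ h v) (hh : ∀ v, 0 < v → h v ≤ min 1 v) (ha : 0 ≤ a)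
    {D : ℝ} (hD : 1 ≤ D) (hquad : ∀ x v, 1 ≤ x → 0 < v → h (x * v) ≤ D * x ^ 2 * h v)
    {x l : ℝ} (hx : 1 ≤ x) (hl : 0 < l) :
    scaledTransform ν a h (x * l) ≤ D * x ^ 2 * scaledTransform ν a h l := by
  have hx0 : 0 < x := zero_lt_one.trans_le hx
  have h1 : ∫ u, h (x * l * u) ∂ν ≤ ∫ u, D * x ^ 2 * h (l * u) ∂ν := by
    refine integral_mono_ae (integrable_comp_mul h0 hfin hmeas hn hh (mul_pos hx0 hl))
      ((integrable_comp_mul h0 hfin hmeas hn hh hl).const_mul _) ?_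
    filter_upwards [ae_pos_of_measure_Iic_zero h0] with u hu
    simpa only [mul_assoc] using hquad x (l * u) hx (mul_pos hl hu)
  rw [integral_const_mul] at h1
  have h2 : x ≤ D * x ^ 2 := by nlinarith
  unfold scaledTransform
  have h3 : a * (x * l) ≤ D * x ^ 2 * (a * l) := by
    have := mul_le_mul_of_nonneg_right h2 (mul_nonneg ha hl.le)
    linarith
  linarith

lemma radialLevyDensity_eq_integral (h0 : ν (Iic 0) = 0) (d : ℕ) (r : ℝ) :
    radialLevyDensity d ν r = ∫ t, heatKernel d t r ∂ν := by
  rw [radialLevyDensity, restrict_Ioi_zero_eq_self h0]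

/-- Upper bound for the radial density; it needs no regular variation. -/
lemma radialLevyDensity_le {d : ℕ} (hd : 3 ≤ d) {m : ℝ → ℝ≥0} (hm : AntitoneOn m (Ioi 0))
    (hν : ν = (volume.restrict (Ioi 0)).withDensity (fun t => (m t : ℝ≥0∞)))
    (hfin : ∫⁻ u, ENNReal.ofReal (min 1 u) ∂ν < ∞) (hmeas : Measurable h)
    (hn : ∀ v, 0 < v → 0 ≤ h v) (hh : ∀ v, 0 < v → h v ≤ min 1 v) (ha : 0 ≤ a)
    {c : ℝ} (hc : 0 < c) (hlow : ∀ v, 1 / 2 ≤ v → v ≤ 1 → c ≤ h v)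
    {D : ℝ} (hD : 1 ≤ D) (hquad : ∀ x v, 1 ≤ x → 0 < v → h (x * v) ≤ D * x ^ 2 * h v) :
    ∃ C, 0 < C ∧ ∀ r, 0 < r →
      radialLevyDensity d ν r ≤ C * (r ^ (-(d : ℝ)) * scaledTransform ν a h (r ^ 2)⁻¹) := by
  have h0 : ν (Iic 0) = 0 := hν ▸ measure_Iic_zero_withDensity
  set I : ℝ := ∫ s in Ioi 0, (1 + s⁻¹ ^ 3) * heatKernel d s 1 with hI
  have hI0 : 0 ≤ I := setIntegral_nonneg measurableSet_Ioi fun s hs =>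
    mul_nonneg (by have : 0 < s := hs; positivity) (heatKernel_nonneg d hs 1)
  refine ⟨2 / c * D * (I + 1), by positivity, fun r hr => ?_⟩
  have hr2 : 0 < r ^ 2 := by positivity
  set T := scaledTransform ν a h (r ^ 2)⁻¹ with hT
  have hT0 : 0 ≤ T := by
    refine add_nonneg (by positivity) (integral_nonneg_of_ae ?_)
    filter_upwards [ae_pos_of_measure_Iic_zero h0] with u hu
      using hn _ (mul_pos (inv_pos.2 hr2) hu)
  -- After the substitution `t = r² s` the density is at most `(1 + s⁻³) r⁻² T`.
  have hmle : ∀ s, 0 < s → (m (r ^ 2 * s) : ℝ) ≤ 2 / c * D * ((r ^ 2)⁻¹ * T) * (1 + s⁻¹ ^ 3) := by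
    intro s hs
    rcases le_total s 1 with h1 | h1
    · refine (density_le_scaledTransform hm hν hfin hmeas hn hh ha hc hlow
        (mul_pos hr2 hs)).trans ?_
      have h2 := scaledTransform_mul_le h0 hfin hmeas hn hh ha hD hquad
        (x := s⁻¹) (l := (r ^ 2)⁻¹) ((one_le_inv₀ hs).2 h1) (inv_pos.2 hr2)
      rw [mul_inv_rev]
      calc 2 / c * (s⁻¹ * (r ^ 2)⁻¹ * scaledTransform ν a h (s⁻¹ * (r ^ 2)⁻¹))
          ≤ 2 / c * (s⁻¹ * (r ^ 2)⁻¹ * (D * s⁻¹ ^ 2 * T)) := by gcongr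
        _ = 2 / c * D * ((r ^ 2)⁻¹ * T) * s⁻¹ ^ 3 := by ring
        _ ≤ _ := by gcongr; linarith
    · have h2 : (m (r ^ 2 * s) : ℝ) ≤ m (r ^ 2) := by
        exact_mod_cast hm hr2 (mul_pos hr2 hs) (le_mul_of_one_le_right hr2.le h1)
      have h3 := density_le_scaledTransform hm hν hfin hmeas hn hh ha hc hlow hr2
      have h4 : (0 : ℝ) ≤ s⁻¹ ^ 3 := by positivity
      calc (m (r ^ 2 * s) : ℝ) ≤ 2 / c * ((r ^ 2)⁻¹ * T) := h2.trans h3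
        _ = 2 / c * 1 * ((r ^ 2)⁻¹ * T) * 1 := by ring
        _ ≤ _ := by gcongr; linarith
  have hsub := integral_comp_mul_left_Ioi (fun t => (m t : ℝ) * heatKernel d t r) 0 hr2
  rw [mul_zero, smul_eq_mul] at hsub
  have hj : radialLevyDensity d ν r
      = r ^ 2 * ∫ s in Ioi 0, (m (r ^ 2 * s) : ℝ) * heatKernel d (r ^ 2 * s) r := by
    rw [hsub, radialLevyDensity_eq_integral h0, mul_inv_cancel_left₀ hr2.ne', hν,
      integral_withDensity_Ioi hm]
  have hle : ∫ s in Ioi 0, (m (r ^ 2 * s) : ℝ) * heatKernel d (r ^ 2 * s) r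
      ≤ ∫ s in Ioi 0, 2 / c * D * ((r ^ 2)⁻¹ * T) * r ^ (-(d : ℝ)) *
          ((1 + s⁻¹ ^ 3) * heatKernel d s 1) := by
    refine integral_mono_of_nonneg ?_ ((integrableOn_heatKernel_weight hd).const_mul _) ?_
    · filter_upwards [ae_restrict_mem measurableSet_Ioi] with s hs
      exact mul_nonneg (by positivity) (heatKernel_nonneg d (mul_pos hr2 hs) r)
    · filter_upwards [ae_restrict_mem measurableSet_Ioi] with s hs
      have hs' : 0 < s := hs
      have hk := heatKernel_nonneg d hs' 1
      have hrd : 0 < r ^ (-(d : ℝ)) := Real.rpow_pos_of_pos hr _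
      simp only [heatKernel_scale d hr hs']
      calc (m (r ^ 2 * s) : ℝ) * (r ^ (-(d : ℝ)) * heatKernel d s 1)
          ≤ 2 / c * D * ((r ^ 2)⁻¹ * T) * (1 + s⁻¹ ^ 3)
              * (r ^ (-(d : ℝ)) * heatKernel d s 1) := by
            gcongr; exact hmle s hs'
        _ = _ := by ring
  rw [integral_const_mul, ← hI] at hle
  rw [hj]
  have hrd : 0 < r ^ (-(d : ℝ)) := Real.rpow_pos_of_pos hr _
  calc _ ≤ r ^ 2 * (2 / c * D * ((r ^ 2)⁻¹ * T) * r ^ (-(d : ℝ)) * I) := by gcongr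
    _ = 2 / c * D * I * (r ^ (-(d : ℝ)) * T) := by field_simp
    _ ≤ _ := by gcongr; linarith

/-- If the parts of the transform near `0` and near `∞` are dominated by its values at `x l` and
`y l`, then the middle part, and with it the density at `δ / l`, controls the rest. -/
lemma scaledTransform_le {m : ℝ → ℝ≥0} (hm : AntitoneOn m (Ioi 0))
    (hν : ν = (volume.restrict (Ioi 0)).withDensity (fun t => (m t : ℝ≥0∞)))
    (hfin : ∫⁻ u, ENNReal.ofReal (min 1 u) ∂ν < ∞) (hmeas : Measurable h)
    (hn : ∀ v, 0 < v → 0 ≤ h v) (hh : ∀ v, 0 < v → h v ≤ min 1 v) (ha : 0 ≤ a)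
    {δ M K₁ K₂ x y : ℝ} (hδ : 0 < δ) (hδM : δ ≤ M) (hK₁ : 0 ≤ K₁) (hK₂ : 0 ≤ K₂) (hx : 0 < x)
    (hy : 0 < y) (hax : a ≤ K₁ * x * a) (hsmall : ∀ v, 0 < v → v ≤ δ → h v ≤ K₁ * h (x * v))
    (hlarge : ∀ v, M ≤ v → h v ≤ K₂ * h (y * v)) {l : ℝ} (hl : 0 < l) :
    scaledTransform ν a h l ≤ K₁ * scaledTransform ν a h (x * l)
      + K₂ * scaledTransform ν a h (y * l) + m (δ / l) * (M / l) := by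
  have h0 : ν (Iic 0) = 0 := hν ▸ measure_Iic_zero_withDensity
  have hpos := ae_pos_of_measure_Iic_zero h0
  have hi := integrable_comp_mul h0 hfin hmeas hn hh hl
  have hix := integrable_comp_mul h0 hfin hmeas hn hh (mul_pos hx hl)
  have hiy := integrable_comp_mul h0 hfin hmeas hn hh (mul_pos hy hl)
  have hfinI : ν (Ioc (δ / l) (M / l)) < ∞ := hν ▸ withDensity_Ioc_lt_top hm (div_pos hδ hl)
  have hmid : ν.real (Ioc (δ / l) (M / l)) ≤ m (δ / l) * (M / l) := by
    have h1 : ν.real (Ioc (δ / l) (M / l)) ≤ m (δ / l) * (M / l - δ / l) :=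
      hν ▸ measureReal_Ioc_le hm (div_pos hδ hl) (by gcongr)
    refine h1.trans ?_
    gcongr
    have := div_pos hδ hl
    linarith
  have hind : Integrable ((Ioc (δ / l) (M / l)).indicator (fun _ : ℝ => (1 : ℝ))) ν :=
    (integrable_indicator_iff measurableSet_Ioc).2 (integrableOn_const hfinI.ne)
  have key : ∫ u, h (l * u) ∂ν ≤ ∫ u, (K₁ * h (x * l * u) + K₂ * h (y * l * u)
      + (Ioc (δ / l) (M / l)).indicator (fun _ => (1 : ℝ)) u) ∂ν := by
    refine integral_mono_ae hi (((hix.const_mul _).add (hiy.const_mul _)).add hind) ?_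
    filter_upwards [hpos] with u hu
    have hlu := mul_pos hl hu
    have p1 : 0 ≤ K₁ * h (x * l * u) := mul_nonneg hK₁ (hn _ (by positivity))
    have p2 : 0 ≤ K₂ * h (y * l * u) := mul_nonneg hK₂ (hn _ (by positivity))
    have p3 : 0 ≤ (Ioc (δ / l) (M / l)).indicator (fun _ => (1 : ℝ)) u :=
      indicator_nonneg (fun _ _ => zero_le_one) u
    rcases le_or_gt (l * u) δ with h1 | h1
    · have := hsmall _ hlu h1
      rw [← mul_assoc] at this
      linarith
    · rcases le_or_gt M (l * u) with h2 | h2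
      · have := hlarge _ h2
        rw [← mul_assoc] at this
        linarith
      · have hu' : u ∈ Ioc (δ / l) (M / l) := by
          refine ⟨?_, ?_⟩
          · rw [div_lt_iff₀ hl]; linarith
          · rw [le_div_iff₀ hl]; linarith
        have := (hh _ hlu).trans (min_le_left _ _)
        rw [indicator_of_mem hu'] at p3 ⊢
        linarith
  have hxy : Integrable (fun u => K₁ * h (x * l * u) + K₂ * h (y * l * u)) ν :=
    (hix.const_mul _).add (hiy.const_mul _)
  rw [integral_add hxy hind,
    integral_add (hix.const_mul _) (hiy.const_mul _), integral_const_mul, integral_const_mul,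
    integral_indicator measurableSet_Ioc, setIntegral_const, smul_eq_mul, mul_one] at key
  unfold scaledTransform
  have h5 : a * l ≤ K₁ * (a * (x * l)) := by nlinarith
  have h6 : 0 ≤ K₂ * (a * (y * l)) := by positivity
  linarith

/-- Lower bound for the radial density, from regular variation of the transform. -/
lemma le_radialLevyDensity (d : ℕ) {m : ℝ → ℝ≥0} (hm : AntitoneOn m (Ioi 0))
    (hν : ν = (volume.restrict (Ioi 0)).withDensity (fun t => (m t : ℝ≥0∞)))
    (hfin : ∫⁻ u, ENNReal.ofReal (min 1 u) ∂ν < ∞) (hmeas : Measurable h)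
    (hn : ∀ v, 0 < v → 0 ≤ h v) (hh : ∀ v, 0 < v → h v ≤ min 1 v) (ha : 0 ≤ a)
    {δ M K₁ K₂ x y : ℝ} (hδ : 0 < δ) (hδM : δ ≤ M) (hK₁ : 0 ≤ K₁) (hK₂ : 0 ≤ K₂) (hx : 0 < x)
    (hy : 0 < y) (hax : a ≤ K₁ * x * a) (hsmall : ∀ v, 0 < v → v ≤ δ → h v ≤ K₁ * h (x * v))
    (hlarge : ∀ v, M ≤ v → h v ≤ K₂ * h (y * v)) {ρ : ℝ}
    (hRV : RegularlyVarying (scaledTransform ν a h) ρ)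
    (hKρ : K₁ * x ^ ρ + K₂ * y ^ ρ < 1) :
    ∃ c, 0 < c ∧ ∀ᶠ r in 𝓝[>] (0 : ℝ),
      c * (r ^ (-(d : ℝ)) * scaledTransform ν a h (r ^ 2)⁻¹) ≤ radialLevyDensity d ν r := by
  have h0 : ν (Iic 0) = 0 := hν ▸ measure_Iic_zero_withDensity
  have hM : 0 < M := hδ.trans_le hδM
  set q := (1 - (K₁ * x ^ ρ + K₂ * y ^ ρ)) / 2 with hq
  have hq0 : 0 < q := by rw [hq]; linarith
  have hlim : Tendsto (fun l => K₁ * (scaledTransform ν a h (l * x) / scaledTransform ν a h l)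
      + K₂ * (scaledTransform ν a h (l * y) / scaledTransform ν a h l)) atTop
      (𝓝 (K₁ * x ^ ρ + K₂ * y ^ ρ)) :=
    ((hRV.2 x hx).const_mul K₁).add ((hRV.2 y hy).const_mul K₂)
  have hev : ∀ᶠ l in atTop, q * (l * scaledTransform ν a h l) ≤ M * m (δ / l) := by
    filter_upwards [hlim.eventually (gt_mem_nhds (show _ < 1 - q by rw [hq]; linarith)),
      eventually_gt_atTop 0] with l hl1 hl
    have hT := hRV.1 l hl
    have hle := scaledTransform_le hm hν hfin hmeas hn hh ha hδ hδM hK₁ hK₂ hx hy hax hsmall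
      hlarge hl
    rw [mul_comm x l, mul_comm y l] at hle
    have h2 : K₁ * scaledTransform ν a h (l * x) + K₂ * scaledTransform ν a h (l * y)
        ≤ (1 - q) * scaledTransform ν a h l := by
      rw [← mul_div_assoc, ← mul_div_assoc, ← add_div, div_lt_iff₀ hT] at hl1
      exact hl1.le
    have h3 : q * scaledTransform ν a h l ≤ m (δ / l) * (M / l) := by linarith
    calc q * (l * scaledTransform ν a h l) = l * (q * scaledTransform ν a h l) := by ring
      _ ≤ l * (m (δ / l) * (M / l)) := by gcongr
      _ = _ := by field_simp
  -- A lower bound for the heat kernel at times in `(δ/2, δ]` and distance one.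
  set κ := (4 * Real.pi * δ) ^ (-((d : ℝ) / 2)) * Real.exp (-(1 ^ 2) / (4 * (δ / 2))) with hκ
  have hκ0 : 0 < κ := by positivity
  have hker : ∀ s, δ / 2 < s → s ≤ δ → κ ≤ heatKernel d s 1 := by
    intro s hs1 hs2
    have hs0 : 0 < s := by linarith
    unfold heatKernel
    rw [hκ]
    refine mul_le_mul ?_ ?_ (by positivity) (by positivity)
    · refine Real.rpow_le_rpow_of_nonpos (by positivity) (by gcongr) ?_
      have : (0 : ℝ) ≤ d := by positivity
      linarith
    · rw [Real.exp_le_exp, neg_div, neg_div, neg_le_neg_iff]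
      gcongr
  have htend : Tendsto (fun r : ℝ => (r ^ 2)⁻¹) (𝓝[>] 0) atTop := by
    refine tendsto_inv_nhdsGT_zero.comp ?_
    refine tendsto_nhdsWithin_of_tendsto_nhds_of_eventually_within _ ?_ ?_
    · have : Tendsto (fun r : ℝ => r ^ 2) (𝓝 0) (𝓝 (0 ^ 2)) := (continuous_pow 2).tendsto 0
      rw [zero_pow two_ne_zero] at this
      exact this.mono_left nhdsWithin_le_nhds
    · filter_upwards [self_mem_nhdsWithin] with r hr
      exact pow_pos (mem_Ioi.1 hr) 2
  refine ⟨κ * (δ / 2) * (q / M), by positivity, ?_⟩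
  filter_upwards [htend.eventually hev, self_mem_nhdsWithin] with r hr1 hr
  replace hr : 0 < r := hr
  have hr2 : 0 < r ^ 2 := by positivity
  have hrd : 0 < r ^ (-(d : ℝ)) := Real.rpow_pos_of_pos hr _
  rw [div_inv_eq_mul] at hr1
  set T := scaledTransform ν a h (r ^ 2)⁻¹ with hT
  have ha' : 0 < r ^ 2 * (δ / 2) := by positivity
  have hfinI : ν (Ioc (r ^ 2 * (δ / 2)) (r ^ 2 * δ)) < ∞ := hν ▸ withDensity_Ioc_lt_top hm ha'
  have h1 : m (r ^ 2 * δ) * (r ^ 2 * δ - r ^ 2 * (δ / 2))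
      ≤ ν.real (Ioc (r ^ 2 * (δ / 2)) (r ^ 2 * δ)) :=
    hν ▸ le_measureReal_Ioc hm ha' (by gcongr; linarith)
  have hint := integrable_heatKernel h0 hfin d hr
  have h2 : r ^ (-(d : ℝ)) * κ * ν.real (Ioc (r ^ 2 * (δ / 2)) (r ^ 2 * δ))
      ≤ ∫ t in Ioc (r ^ 2 * (δ / 2)) (r ^ 2 * δ), heatKernel d t r ∂ν := by
    rw [mul_comm _ (ν.real _), ← smul_eq_mul (ν.real _), ← setIntegral_const]
    refine setIntegral_mono_on (integrableOn_const hfinI.ne) hint.integrableOn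
      measurableSet_Ioc fun t ht => ?_
    have e : t = r ^ 2 * (t / r ^ 2) := by field_simp
    have hs1 : δ / 2 < t / r ^ 2 := by rw [lt_div_iff₀ hr2]; linarith [ht.1]
    have hs2 : t / r ^ 2 ≤ δ := by rw [div_le_iff₀ hr2]; linarith [ht.2]
    rw [e, heatKernel_scale d hr (by linarith)]
    gcongr
    exact hker _ hs1 hs2
  have h3 : ∫ t in Ioc (r ^ 2 * (δ / 2)) (r ^ 2 * δ), heatKernel d t r ∂ν
      ≤ radialLevyDensity d ν r := by
    rw [radialLevyDensity_eq_integral h0]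
    refine setIntegral_le_integral hint ?_
    filter_upwards [ae_pos_of_measure_Iic_zero h0] with u hu using heatKernel_nonneg d hu r
  refine le_trans ?_ (h2.trans h3)
  have h4 : q / M * ((r ^ 2)⁻¹ * T) ≤ m (r ^ 2 * δ) := by
    rw [div_mul_eq_mul_div, div_le_iff₀ hM, mul_comm (r ^ 2) δ]; linarith
  calc κ * (δ / 2) * (q / M) * (r ^ (-(d : ℝ)) * T)
      = r ^ (-(d : ℝ)) * κ * (q / M * ((r ^ 2)⁻¹ * T) * (r ^ 2 * δ - r ^ 2 * (δ / 2))) := by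
        field_simp; ring
    _ ≤ r ^ (-(d : ℝ)) * κ * (m (r ^ 2 * δ) * (r ^ 2 * δ - r ^ 2 * (δ / 2))) := by
        gcongr
        nlinarith
    _ ≤ _ := by gcongr

/-- A function squeezed between two multiples of a positive one is comparable to it. -/
lemma ComparableAtZero.of_bounds {f g : ℝ → ℝ} {c C : ℝ} (hc : 0 < c) (hC : 0 < C)
    (hg : ∀ r, 0 < r → 0 < g r) (hlow : ∀ᶠ r in 𝓝[>] (0 : ℝ), c * g r ≤ f r)
    (hup : ∀ r, 0 < r → f r ≤ C * g r) : ComparableAtZero f g := by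
  refine ⟨c, C, hc, hC, ?_⟩
  filter_upwards [hlow, self_mem_nhdsWithin] with r h1 hr
  exact ⟨(le_div_iff₀ (hg r hr)).2 h1, (div_le_iff₀ (hg r hr)).2 (hup r hr)⟩

end ScaledTransform

/-! ### The Laplace exponent and its derivative -/

section LaplaceExponent

lemma one_sub_exp_neg_le_min (v : ℝ) : 1 - Real.exp (-v) ≤ min 1 v := by
  refine le_min (by linarith [Real.exp_pos (-v)]) (by linarith [Real.add_one_le_exp (-v)])

lemma one_sub_exp_neg_nonneg {v : ℝ} (hv : 0 < v) : 0 ≤ 1 - Real.exp (-v) := by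
  have := Real.exp_le_one_iff.2 (neg_nonpos.2 hv.le)
  linarith

lemma mul_exp_neg_le_min {v : ℝ} (hv : 0 < v) : v * Real.exp (-v) ≤ min 1 v := by
  refine le_min ?_ (mul_le_of_le_one_right hv.le (Real.exp_le_one_iff.2 (by linarith)))
  rw [Real.exp_neg, ← div_eq_mul_inv, div_le_one (Real.exp_pos v)]
  linarith [Real.add_one_le_exp v]

/-- The kernel of `φ(l) - l φ'(l)` is comparable to `1 ∧ v²`: upper bound. -/
lemma one_sub_add_mul_exp_neg_le {v : ℝ} (hv : 0 < v) :
    1 - Real.exp (-v) - v * Real.exp (-v) ≤ min 1 (v ^ 2) := by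
  have h1 := Real.exp_pos (-v)
  have h2 := Real.add_one_le_exp (-v)
  refine le_min (by nlinarith) (by nlinarith)

/-- The kernel of `φ(l) - l φ'(l)` is comparable to `1 ∧ v²`: lower bound. -/
lemma le_one_sub_add_mul_exp_neg {v : ℝ} (hv : 0 < v) :
    min 1 (v ^ 2) ≤ 5 * (1 - Real.exp (-v) - v * Real.exp (-v)) := by
  have h1 : 1 + v + v ^ 2 / 2 ≤ Real.exp v := Real.quadratic_le_exp_of_nonneg hv.le
  have h2 : Real.exp (-v) * (1 + v + v ^ 2 / 2) ≤ 1 := by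
    calc Real.exp (-v) * (1 + v + v ^ 2 / 2) ≤ Real.exp (-v) * Real.exp v := by gcongr
      _ = 1 := by rw [← Real.exp_add]; simp
  have h3 : Real.exp (-v) ≤ 1 / (1 + v + v ^ 2 / 2) := by
    rw [le_div_iff₀ (by positivity)]; exact h2
  have h4 : (1 + v) * Real.exp (-v) ≤ (1 + v) / (1 + v + v ^ 2 / 2) := by
    rw [div_eq_mul_one_div]; gcongr
  have h5 : min 1 (v ^ 2) / 5 + (1 + v) / (1 + v + v ^ 2 / 2) ≤ 1 := by
    rw [← le_sub_iff_add_le, one_sub_div (by positivity), le_div_iff₀ (by positivity)]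
    rcases le_total v 1 with h | h
    · rw [min_eq_right (by nlinarith)]
      have h6 : 1 + v + v ^ 2 / 2 ≤ 5 / 2 := by nlinarith
      nlinarith [mul_le_mul_of_nonneg_left h6 (sq_nonneg v)]
    · rw [min_eq_left (by nlinarith)]; nlinarith
  linarith

variable {ν : Measure ℝ}

lemma hasDerivAt_integral_one_sub_exp (h0 : ν (Iic 0) = 0)
    (hfin : ∫⁻ u, ENNReal.ofReal (min 1 u) ∂ν < ∞) {l : ℝ} (hl : 0 < l) :
    HasDerivAt (fun l => ∫ u, (1 - Real.exp (-(l * u))) ∂ν)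
      (∫ u, u * Real.exp (-(l * u)) ∂ν) l := by
  have hpos := ae_pos_of_measure_Iic_zero h0
  have hl2 : 0 < l / 2 := half_pos hl
  refine (hasDerivAt_integral_of_dominated_loc_of_deriv_le
    (F := fun l u => 1 - Real.exp (-(l * u))) (F' := fun l u => u * Real.exp (-(l * u)))
    (s := Ioi (l / 2)) (bound := fun u => u * Real.exp (-(l / 2 * u)))
    (Ioi_mem_nhds (by linarith)) ?_ ?_ ?_ ?_ ?_ ?_).2
  · exact Eventually.of_forall fun x => by fun_prop
  · exact integrable_comp_mul (h := fun v => 1 - Real.exp (-v)) h0 hfin (by fun_prop)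
      (fun v => one_sub_exp_neg_nonneg) (fun v _ => one_sub_exp_neg_le_min v) hl
  · fun_prop
  · filter_upwards [hpos] with u hu x hx
    have hx' : l / 2 < x := hx
    rw [Real.norm_of_nonneg (by positivity)]
    gcongr
  · have := (integrable_comp_mul (h := fun v => v * Real.exp (-v)) h0 hfin (by fun_prop)
      (fun v hv => by positivity) (fun v => mul_exp_neg_le_min) hl2).const_mul (l / 2)⁻¹
    refine this.congr (Eventually.of_forall fun u => ?_)
    simp only
    rw [← mul_assoc, inv_mul_cancel_left₀ hl2.ne']
  · filter_upwards with u x _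
    have h1 : HasDerivAt (fun x : ℝ => -(x * u)) (-u) x := by
      simpa using ((hasDerivAt_id x).mul_const u).fun_neg
    have h2 := (h1.exp).const_sub 1
    convert h2 using 1
    ring

variable {Ω : Type*} [MeasurableSpace Ω] {P : Measure Ω} {S : ℝ≥0 → Ω → ℝ} {γ : ℝ}

/-- The identity `E[exp(-l Sₜ)] = exp(-t (γ l + ∫ (1 - exp(-l u)) ν(du)))`. -/
def HasLaplaceRepresentation (S : ℝ≥0 → Ω → ℝ) (P : Measure Ω) (ν : Measure ℝ) (γ : ℝ) : Prop :=
  ∀ (t : ℝ≥0) (l : ℝ), 0 < l →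
      ∫ ω, Real.exp (-l * S t ω) ∂P
        = Real.exp (-(t : ℝ) * (γ * l + ∫ u in Ioi (0 : ℝ), (1 - Real.exp (-l * u)) ∂ν))

lemma laplaceExponent_eq (h0 : ν (Iic 0) = 0) (hrep : HasLaplaceRepresentation S P ν γ)
    {l : ℝ} (hl : 0 < l) :
    laplaceExponent S P l = γ * l + ∫ u, (1 - Real.exp (-(l * u))) ∂ν := by
  rw [laplaceExponent, hrep 1 l hl, Real.log_exp, restrict_Ioi_zero_eq_self h0]
  simp [neg_mul]

lemma hasDerivAt_laplaceExponent (h0 : ν (Iic 0) = 0)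
    (hfin : ∫⁻ u, ENNReal.ofReal (min 1 u) ∂ν < ∞) (hrep : HasLaplaceRepresentation S P ν γ)
    {l : ℝ} (hl : 0 < l) :
    HasDerivAt (laplaceExponent S P) (γ + ∫ u, u * Real.exp (-(l * u)) ∂ν) l := by
  have h1 : HasDerivAt (fun l : ℝ => γ * l) γ l := by
    simpa using (hasDerivAt_id l).const_mul γ
  refine (h1.add (hasDerivAt_integral_one_sub_exp h0 hfin hl)).congr_of_eventuallyEq ?_
  filter_upwards [Ioi_mem_nhds hl] with x hx
  simpa using laplaceExponent_eq h0 hrep hx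

/-- `l φ'(l)` as a scaled transform. -/
lemma mul_deriv_laplaceExponent_eq (h0 : ν (Iic 0) = 0)
    (hfin : ∫⁻ u, ENNReal.ofReal (min 1 u) ∂ν < ∞) (hrep : HasLaplaceRepresentation S P ν γ)
    {l : ℝ} (hl : 0 < l) :
    l * deriv (laplaceExponent S P) l
      = scaledTransform ν γ (fun v => v * Real.exp (-v)) l := by
  rw [(hasDerivAt_laplaceExponent h0 hfin hrep hl).deriv, scaledTransform, mul_add,
    ← integral_const_mul, mul_comm γ]
  simp only [mul_assoc]

/-- `φ(l) - l φ'(l)` as a scaled transform; the drift cancels. -/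
lemma laplaceExponent_sub_mul_deriv_eq (h0 : ν (Iic 0) = 0)
    (hfin : ∫⁻ u, ENNReal.ofReal (min 1 u) ∂ν < ∞) (hrep : HasLaplaceRepresentation S P ν γ)
    {l : ℝ} (hl : 0 < l) :
    laplaceExponent S P l - l * deriv (laplaceExponent S P) l
      = scaledTransform ν 0 (fun v => 1 - Real.exp (-v) - v * Real.exp (-v)) l := by
  have h1 := integrable_comp_mul (h := fun v => 1 - Real.exp (-v)) h0 hfin (by fun_prop)
    (fun v => one_sub_exp_neg_nonneg) (fun v _ => one_sub_exp_neg_le_min v) hl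
  have h2 := integrable_comp_mul (h := fun v => v * Real.exp (-v)) h0 hfin (by fun_prop)
    (fun v hv => by positivity) (fun v => mul_exp_neg_le_min) hl
  rw [mul_deriv_laplaceExponent_eq h0 hfin hrep hl, laplaceExponent_eq h0 hrep hl,
    scaledTransform, scaledTransform, integral_sub h1 h2]
  ring

lemma one_sub_add_mul_exp_neg_nonneg {v : ℝ} (hv : 0 < v) :
    0 ≤ 1 - Real.exp (-v) - v * Real.exp (-v) := by
  have h1 := le_one_sub_add_mul_exp_neg hv
  have h2 : 0 ≤ min 1 (v ^ 2) := by positivity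
  linarith

lemma one_sub_add_mul_exp_neg_le_min {v : ℝ} (hv : 0 < v) :
    1 - Real.exp (-v) - v * Real.exp (-v) ≤ min 1 v := by
  refine (sub_le_self _ (by positivity)).trans (one_sub_exp_neg_le_min v)

/-- `φ(l) → ∞` because `ν` has infinite mass. -/
lemma tendsto_laplaceExponent_atTop (h0 : ν (Iic 0) = 0)
    (hfin : ∫⁻ u, ENNReal.ofReal (min 1 u) ∂ν < ∞) (hγ : 0 ≤ γ)
    (hrep : HasLaplaceRepresentation S P ν γ) (hinf : ν univ = ∞) :
    Tendsto (laplaceExponent S P) atTop atTop := by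
  have hpos := ae_pos_of_measure_Iic_zero h0
  have hlim : Tendsto (fun l : ℝ => ∫⁻ u, ENNReal.ofReal (1 - Real.exp (-(l * u))) ∂ν) atTop
      (𝓝 ∞) := by
    have hmono : Tendsto (fun n : ℕ => ∫⁻ u, ENNReal.ofReal (1 - Real.exp (-((n : ℝ) * u))) ∂ν)
        atTop (𝓝 (∫⁻ _, 1 ∂ν)) := by
      refine lintegral_tendsto_of_tendsto_of_monotone (fun n => by fun_prop) ?_ ?_
      · filter_upwards [hpos] with u hu n k hnk
        refine ENNReal.ofReal_le_ofReal ?_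
        have : (n : ℝ) ≤ k := by exact_mod_cast hnk
        gcongr
      · filter_upwards [hpos] with u hu
        have h1 : Tendsto (fun n : ℕ => Real.exp (-((n : ℝ) * u))) atTop (𝓝 0) :=
          Real.tendsto_exp_neg_atTop_nhds_zero.comp
            (tendsto_natCast_atTop_atTop.atTop_mul_const hu)
        have h2 := ENNReal.tendsto_ofReal (h1.const_sub 1)
        simpa using h2
    rw [lintegral_one, hinf] at hmono
    refine tendsto_of_tendsto_of_tendsto_of_le_of_le'
      (hmono.comp (tendsto_nat_floor_atTop (α := ℝ))) tendsto_const_nhds ?_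
      (Eventually.of_forall fun _ => le_top)
    filter_upwards [eventually_ge_atTop 0] with l hl
    refine lintegral_mono_ae ?_
    filter_upwards [hpos] with u hu
    refine ENNReal.ofReal_le_ofReal ?_
    have : (⌊l⌋₊ : ℝ) ≤ l := Nat.floor_le hl
    gcongr
  rw [tendsto_atTop]
  intro b
  filter_upwards [hlim.eventually (lt_mem_nhds (show ENNReal.ofReal b < ∞ from
    ENNReal.ofReal_lt_top)), eventually_gt_atTop 0] with l hb hl
  have hi := integrable_comp_mul (h := fun v => 1 - Real.exp (-v)) h0 hfin (by fun_prop)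
      (fun v => one_sub_exp_neg_nonneg) (fun v _ => one_sub_exp_neg_le_min v) hl
  rw [← ofReal_integral_eq_lintegral_ofReal hi] at hb
  · have h1 := lt_of_not_ge fun h => hb.not_ge (ENNReal.ofReal_le_ofReal h)
    rw [laplaceExponent_eq h0 hrep hl]
    have : 0 ≤ γ * l := by positivity
    linarith
  · filter_upwards [hpos] with u hu using one_sub_exp_neg_nonneg (mul_pos hl hu)

end LaplaceExponent

/-! ### Regular variation -/

section RegularVariation

/-- Integrating a slowly varying derivative: if `f → ∞` and `f'` is slowly varying, then `f` is
regularly varying of index one. -/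
lemma tendsto_div_of_deriv_slowlyVarying {f f' : ℝ → ℝ}
    (hf : ∀ l, 0 < l → HasDerivAt f (f' l) l) (hpos : ∀ l, 0 < l → 0 < f' l)
    (hlim : Tendsto f atTop atTop)
    (hsv : ∀ x, 0 < x → Tendsto (fun l => f' (l * x) / f' l) atTop (𝓝 1))
    {x : ℝ} (hx : 0 < x) : Tendsto (fun l => f (l * x) / f l) atTop (𝓝 x) := by
  have hder : ∀ k l, 0 < l → HasDerivAt (fun l => f (l * x) - k * f l)
      (f' (l * x) * x - k * f' l) l := fun k l hl => by
    have h1 : HasDerivAt (fun l : ℝ => l * x) x l := by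
      simpa using (hasDerivAt_id l).mul_const x
    exact ((hf _ (mul_pos hl hx)).comp l h1).sub ((hf l hl).const_mul k)
  have hquot : Tendsto (fun l => f' (l * x) * x / f' l) atTop (𝓝 x) := by
    have := (hsv x hx).mul_const x
    rw [one_mul] at this
    exact this.congr fun l => by ring
  -- The difference `f (l x) - k f l` is eventually monotone for every `k ≠ x`, and `f → ∞`
  -- makes the constant of integration negligible.
  refine tendsto_order.2 ⟨fun k hk => ?_, fun k hk => ?_⟩
  · obtain ⟨k', hk1, hk2⟩ := exists_between hk
    obtain ⟨L, hL⟩ := eventually_atTop.1 ((hquot.eventually (lt_mem_nhds hk2)).and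
      (eventually_gt_atTop 0))
    have hmono : MonotoneOn (fun l => f (l * x) - k' * f l) (Ici L) := by
      refine monotoneOn_of_deriv_nonneg (convex_Ici L)
        (fun l hl => (hder k' l (hL l hl).2).continuousAt.continuousWithinAt)
        (fun l hl => ?_) (fun l hl => ?_)
      · rw [interior_Ici] at hl
        exact (hder k' l (hL l (le_of_lt hl)).2).differentiableAt.differentiableWithinAt
      · rw [interior_Ici] at hl
        have h := hL l (le_of_lt hl)
        rw [(hder k' l h.2).deriv]
        have := (lt_div_iff₀ (hpos l h.2)).1 h.1
        linarith
    filter_upwards [eventually_ge_atTop L, hlim.eventually_gt_atTop 0,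
      hlim.eventually_gt_atTop (-(f (L * x) - k' * f L) / (k' - k))] with l hl hf0 hfl
    have h1 := hmono self_mem_Ici hl hl
    simp only at h1
    rw [div_lt_iff₀ (by linarith)] at hfl
    rw [lt_div_iff₀ hf0]
    nlinarith
  · obtain ⟨k', hk1, hk2⟩ := exists_between hk
    obtain ⟨L, hL⟩ := eventually_atTop.1 ((hquot.eventually (gt_mem_nhds hk1)).and
      (eventually_gt_atTop 0))
    have hmono : AntitoneOn (fun l => f (l * x) - k' * f l) (Ici L) := by
      refine antitoneOn_of_deriv_nonpos (convex_Ici L)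
        (fun l hl => (hder k' l (hL l hl).2).continuousAt.continuousWithinAt)
        (fun l hl => ?_) (fun l hl => ?_)
      · rw [interior_Ici] at hl
        exact (hder k' l (hL l (le_of_lt hl)).2).differentiableAt.differentiableWithinAt
      · rw [interior_Ici] at hl
        have h := hL l (le_of_lt hl)
        rw [(hder k' l h.2).deriv]
        have := (div_lt_iff₀ (hpos l h.2)).1 h.1
        linarith
    filter_upwards [eventually_ge_atTop L, hlim.eventually_gt_atTop 0,
      hlim.eventually_gt_atTop ((f (L * x) - k' * f L) / (k - k'))] with l hl hf0 hfl
    have h1 := hmono self_mem_Ici hl hl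
    simp only at h1
    rw [div_lt_iff₀ (by linarith)] at hfl
    rw [div_lt_iff₀ hf0]
    nlinarith

variable {ν : Measure ℝ} {Ω : Type*} [MeasurableSpace Ω] {P : Measure Ω} {S : ℝ≥0 → Ω → ℝ}
  {γ : ℝ}

lemma regularlyVarying_mul_deriv_laplaceExponent (h0 : ν (Iic 0) = 0)
    (hfin : ∫⁻ u, ENNReal.ofReal (min 1 u) ∂ν < ∞) (hrep : HasLaplaceRepresentation S P ν γ)
    {ρ : ℝ} (hRV : RegularlyVarying (deriv (laplaceExponent S P)) (ρ - 1)) :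
    RegularlyVarying (scaledTransform ν γ (fun v => v * Real.exp (-v))) ρ := by
  refine ⟨fun l hl => ?_, fun x hx => ?_⟩
  · rw [← mul_deriv_laplaceExponent_eq h0 hfin hrep hl]
    exact mul_pos hl (hRV.1 l hl)
  · have h1 := (hRV.2 x hx).const_mul x
    have h2 : x * x ^ (ρ - 1) = x ^ ρ := by
      rw [Real.rpow_sub_one hx.ne']; field_simp
    rw [h2] at h1
    refine h1.congr' ?_
    filter_upwards [eventually_gt_atTop 0] with l hl
    rw [← mul_deriv_laplaceExponent_eq h0 hfin hrep hl,
      ← mul_deriv_laplaceExponent_eq h0 hfin hrep (mul_pos hl hx)]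
    have := (hRV.1 l hl).ne'
    field_simp

lemma laplaceExponent_pos (h0 : ν (Iic 0) = 0)
    (hfin : ∫⁻ u, ENNReal.ofReal (min 1 u) ∂ν < ∞) (hrep : HasLaplaceRepresentation S P ν γ)
    {l : ℝ} (hl : 0 < l) (hd : 0 < deriv (laplaceExponent S P) l) :
    0 < laplaceExponent S P l := by
  have h1 := laplaceExponent_sub_mul_deriv_eq h0 hfin hrep hl
  have h2 : 0 ≤ scaledTransform ν 0 (fun v => 1 - Real.exp (-v) - v * Real.exp (-v)) l := by
    rw [scaledTransform, zero_mul, zero_add]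
    refine integral_nonneg_of_ae ?_
    filter_upwards [ae_pos_of_measure_Iic_zero h0] with u hu
      using one_sub_add_mul_exp_neg_nonneg (mul_pos hl hu)
  have := mul_pos hl hd
  linarith

/-- When `φ'` is slowly varying, `φ - l φ' = (l / φ)' φ²` is regularly varying of index one as soon
as `(l / φ)'` is regularly varying of index minus one. -/
lemma regularlyVarying_laplaceExponent_sub_mul_deriv (h0 : ν (Iic 0) = 0)
    (hfin : ∫⁻ u, ENNReal.ofReal (min 1 u) ∂ν < ∞) (hγ : 0 ≤ γ)
    (hrep : HasLaplaceRepresentation S P ν γ) (hinf : ν univ = ∞)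
    (hRV : RegularlyVarying (deriv (laplaceExponent S P)) 0)
    (hRV' : RegularlyVarying (deriv (fun l => l / laplaceExponent S P l)) (-1)) :
    RegularlyVarying
      (scaledTransform ν 0 (fun v => 1 - Real.exp (-v) - v * Real.exp (-v))) 1 := by
  have hφ : ∀ l, 0 < l → 0 < laplaceExponent S P l := fun l hl =>
    laplaceExponent_pos h0 hfin hrep hl (hRV.1 l hl)
  have hder : ∀ l, 0 < l → HasDerivAt (laplaceExponent S P) (deriv (laplaceExponent S P) l) l :=
    fun l hl => (hasDerivAt_laplaceExponent h0 hfin hrep hl).differentiableAt.hasDerivAt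
  have heq : ∀ l, 0 < l → scaledTransform ν 0 (fun v => 1 - Real.exp (-v) - v * Real.exp (-v)) l
      = deriv (fun l => l / laplaceExponent S P l) l * laplaceExponent S P l ^ 2 := by
    intro l hl
    have h1 := ((hasDerivAt_id l).div (hder l hl) (hφ l hl).ne').deriv
    have h2 : deriv (fun l => l / laplaceExponent S P l) l
        = (1 * laplaceExponent S P l - l * deriv (laplaceExponent S P) l)
          / laplaceExponent S P l ^ 2 := h1
    rw [h2, div_mul_cancel₀ _ (pow_ne_zero 2 (hφ l hl).ne'), one_mul,
      laplaceExponent_sub_mul_deriv_eq h0 hfin hrep hl]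
  refine ⟨fun l hl => ?_, fun x hx => ?_⟩
  · rw [heq l hl]
    exact mul_pos (hRV'.1 l hl) (pow_pos (hφ l hl) 2)
  · have hone := tendsto_div_of_deriv_slowlyVarying hder hRV.1
      (tendsto_laplaceExponent_atTop h0 hfin hγ hrep hinf)
      (fun x hx => by simpa using hRV.2 x hx) hx
    have h1 := (hRV'.2 x hx).mul (hone.pow 2)
    have h2 : x ^ (-1 : ℝ) * x ^ 2 = x ^ (1 : ℝ) := by
      rw [Real.rpow_neg_one, Real.rpow_one]; field_simp
    rw [h2] at h1
    refine h1.congr' ?_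
    filter_upwards [eventually_gt_atTop 0] with l hl
    rw [heq l hl, heq _ (mul_pos hl hx)]
    ring

end RegularVariation

/-! ### Comparison of the radial density with the Laplace exponent -/

section Comparison

variable {ν : Measure ℝ} {Ω : Type*} [MeasurableSpace Ω] {P : Measure Ω} {S : ℝ≥0 → Ω → ℝ}
  {γ : ℝ} {d : ℕ}

lemma inv_sq_eq_rpow_neg_two {r : ℝ} (hr : 0 < r) : (r ^ 2)⁻¹ = r ^ (-2 : ℝ) := by
  rw [Real.rpow_neg hr.le]; norm_num

lemma comparableAtZero_of_index_lt_one (hd : 3 ≤ d) (hγ : 0 ≤ γ)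
    (hfin : ∫⁻ u, ENNReal.ofReal (min 1 u) ∂ν < ∞) (hrep : HasLaplaceRepresentation S P ν γ)
    (hdens : HasDecreasingDensity ν) {ρ : ℝ} (hρ0 : 0 ≤ ρ) (hρ : ρ < 1)
    (hRV : RegularlyVarying (deriv (laplaceExponent S P)) (ρ - 1)) :
    ComparableAtZero (radialLevyDensity d ν)
        (fun r => r ^ (-(d : ℝ) - 2) * deriv (laplaceExponent S P) (r ^ (-2 : ℝ))) := by
  obtain ⟨m, hm, hν⟩ := hdens
  have h0 : ν (Iic 0) = 0 := hν ▸ measure_Iic_zero_withDensity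
  have hRV1 := regularlyVarying_mul_deriv_laplaceExponent h0 hfin hrep hRV
  have hmeas : Measurable (fun v : ℝ => v * Real.exp (-v)) := by fun_prop
  have hn : ∀ v : ℝ, 0 < v → 0 ≤ v * Real.exp (-v) := fun v hv => by positivity
  have hh : ∀ v : ℝ, 0 < v → v * Real.exp (-v) ≤ min 1 v := fun v => mul_exp_neg_le_min
  have heq : ∀ r : ℝ, 0 < r → r ^ (-(d : ℝ)) * scaledTransform ν γ (fun v => v * Real.exp (-v))
      (r ^ 2)⁻¹ = r ^ (-(d : ℝ) - 2) * deriv (laplaceExponent S P) (r ^ (-2 : ℝ)) := by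
    intro r hr
    rw [← mul_deriv_laplaceExponent_eq h0 hfin hrep (by positivity), inv_sq_eq_rpow_neg_two hr,
      ← mul_assoc, ← Real.rpow_add hr]
    rfl
  obtain ⟨C, hC0, hC⟩ := radialLevyDensity_le (h := fun v => v * Real.exp (-v)) (a := γ)
    (c := 1 / 2 * Real.exp (-1)) (D := 1) hd hm hν hfin hmeas hn hh hγ (by positivity)
    (fun v hv1 hv2 => by gcongr) le_rfl (fun x v hx hv => by
      have : Real.exp (-(x * v)) ≤ Real.exp (-v) := by
        rw [Real.exp_le_exp]; nlinarith
      calc x * v * Real.exp (-(x * v)) ≤ x ^ 2 * v * Real.exp (-v) := by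
            gcongr; nlinarith
        _ = _ := by ring)
  -- The parameters: `δ` makes the mass near zero small, `M` the mass near infinity.
  obtain ⟨δ, hδ0, hδ1, hδ⟩ : ∃ δ : ℝ, 0 < δ ∧ δ ≤ 1 ∧ Real.exp 1 * δ * δ⁻¹ ^ ρ < 1 / 4 := by
    have h1 : Tendsto (fun δ : ℝ => Real.exp 1 * δ ^ (1 - ρ)) (𝓝[>] 0)
        (𝓝 (Real.exp 1 * 0 ^ (1 - ρ))) :=
      (((Real.continuousAt_rpow_const 0 (1 - ρ) (Or.inr (by linarith))).tendsto).mono_left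
        nhdsWithin_le_nhds).const_mul _
    rw [Real.zero_rpow (by linarith), mul_zero] at h1
    obtain ⟨δ, hδ1, hδ2, hδ3⟩ := ((h1.eventually (gt_mem_nhds (show (0 : ℝ) < 1 / 4 by
      norm_num))).and (Ioc_mem_nhdsGT zero_lt_one)).exists
    refine ⟨δ, hδ2, hδ3, ?_⟩
    rwa [Real.inv_rpow hδ2.le, mul_assoc, ← div_eq_mul_inv,
      ← Real.rpow_one_sub' hδ2.le (by linarith)]
  obtain ⟨M, hM1, hM⟩ : ∃ M : ℝ, 1 ≤ M ∧ 2 * Real.exp (-(M / 2)) < 1 / 4 := by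
    have h1 : Tendsto (fun M : ℝ => 2 * Real.exp (-(M / 2))) atTop (𝓝 (2 * 0)) :=
      (Real.tendsto_exp_neg_atTop_nhds_zero.comp
        (tendsto_id.atTop_div_const two_pos)).const_mul 2
    rw [mul_zero] at h1
    obtain ⟨M, h2, h3⟩ := ((h1.eventually (gt_mem_nhds (show (0 : ℝ) < 1 / 4 by
      norm_num))).and (eventually_ge_atTop 1)).exists
    exact ⟨M, h3, h2⟩
  obtain ⟨c, hc0, hc⟩ := le_radialLevyDensity d (h := fun v => v * Real.exp (-v)) (a := γ)
    (δ := δ) (M := M) (K₁ := Real.exp 1 * δ) (K₂ := 2 * Real.exp (-(M / 2))) (x := δ⁻¹)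
    (y := 1 / 2) hm hν hfin hmeas hn hh hγ hδ0 (hδ1.trans hM1) (by positivity) (by positivity)
    (by positivity) (by norm_num)
    (by
      rw [mul_inv_cancel_right₀ hδ0.ne']
      exact le_mul_of_one_le_left hγ (Real.one_le_exp zero_le_one))
    (fun v hv hvδ => by
      have h1 : δ⁻¹ * v ≤ 1 := by rw [inv_mul_le_iff₀ hδ0]; linarith
      have h2 : 1 ≤ Real.exp 1 * Real.exp (-(δ⁻¹ * v)) := by
        rw [← Real.exp_add]; exact Real.one_le_exp (by linarith)
      calc v * Real.exp (-v) ≤ v * 1 := by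
            gcongr; exact Real.exp_le_one_iff.2 (by linarith)
        _ ≤ v * (Real.exp 1 * Real.exp (-(δ⁻¹ * v))) := by gcongr
        _ = _ := by field_simp)
    (fun v hv => by
      have h1 : Real.exp (-v) = Real.exp (-(v / 2)) * Real.exp (-(1 / 2 * v)) := by
        rw [← Real.exp_add]; ring_nf
      have hv0 : 0 ≤ v := by linarith
      calc v * Real.exp (-v) = v * (Real.exp (-(v / 2)) * Real.exp (-(1 / 2 * v))) := by rw [h1]
        _ ≤ v * (Real.exp (-(M / 2)) * Real.exp (-(1 / 2 * v))) := by gcongr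
        _ = _ := by ring)
    hRV1
    (by
      have h1 : (1 / 2 : ℝ) ^ ρ ≤ 1 := Real.rpow_le_one (by norm_num) (by norm_num) hρ0
      have h2 : 2 * Real.exp (-(M / 2)) * (1 / 2 : ℝ) ^ ρ ≤ 2 * Real.exp (-(M / 2)) * 1 := by
        gcongr
      linarith)
  refine ComparableAtZero.of_bounds hc0 hC0 (fun r hr => ?_) ?_ (fun r hr => ?_)
  · rw [← heq r hr]
    exact mul_pos (Real.rpow_pos_of_pos hr _) (hRV1.1 _ (by positivity))
  · filter_upwards [hc, self_mem_nhdsWithin] with r h1 hr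
    rwa [heq r hr] at h1
  · rw [← heq r hr]; exact hC r hr

lemma comparableAtZero_of_index_one (hd : 3 ≤ d) (hγ : 0 ≤ γ)
    (hfin : ∫⁻ u, ENNReal.ofReal (min 1 u) ∂ν < ∞) (hrep : HasLaplaceRepresentation S P ν γ)
    (hinf : ν univ = ∞) (hdens : HasDecreasingDensity ν)
    (hRV : RegularlyVarying (deriv (laplaceExponent S P)) 0)
    (hRV' : RegularlyVarying (deriv (fun l => l / laplaceExponent S P l)) (-1)) :
    ComparableAtZero (radialLevyDensity d ν)
        (fun r => r ^ (-(d : ℝ) - 2) *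
          (r ^ 2 * laplaceExponent S P (r ^ (-2 : ℝ))
            - deriv (laplaceExponent S P) (r ^ (-2 : ℝ)))) := by
  obtain ⟨m, hm, hν⟩ := hdens
  have h0 : ν (Iic 0) = 0 := hν ▸ measure_Iic_zero_withDensity
  have hRV1 := regularlyVarying_laplaceExponent_sub_mul_deriv h0 hfin hγ hrep hinf hRV hRV'
  set h : ℝ → ℝ := fun v => 1 - Real.exp (-v) - v * Real.exp (-v) with hdef
  have hmeas : Measurable h := by fun_prop
  have hn : ∀ v : ℝ, 0 < v → 0 ≤ h v := fun v => one_sub_add_mul_exp_neg_nonneg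
  have hh : ∀ v : ℝ, 0 < v → h v ≤ min 1 v := fun v => one_sub_add_mul_exp_neg_le_min
  have hup : ∀ v : ℝ, 0 < v → h v ≤ min 1 (v ^ 2) := fun v => one_sub_add_mul_exp_neg_le
  have hlow : ∀ v : ℝ, 0 < v → min 1 (v ^ 2) ≤ 5 * h v := fun v => le_one_sub_add_mul_exp_neg
  have heq : ∀ r : ℝ, 0 < r → r ^ (-(d : ℝ)) * scaledTransform ν 0 h (r ^ 2)⁻¹
      = r ^ (-(d : ℝ) - 2) * (r ^ 2 * laplaceExponent S P (r ^ (-2 : ℝ))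
            - deriv (laplaceExponent S P) (r ^ (-2 : ℝ))) := by
    intro r hr
    rw [← laplaceExponent_sub_mul_deriv_eq h0 hfin hrep (by positivity),
      ← inv_sq_eq_rpow_neg_two hr, Real.rpow_sub hr]
    norm_num
    field_simp
  obtain ⟨C, hC0, hC⟩ := radialLevyDensity_le (h := h) (a := 0)
    (c := 1 / 20) (D := 5) hd hm hν hfin hmeas hn hh le_rfl (by norm_num)
    (fun v hv1 hv2 => by
      have h1 := hlow v (by linarith)
      have h2 : (1 / 4 : ℝ) ≤ min 1 (v ^ 2) := le_min (by norm_num) (by nlinarith)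
      linarith) (by norm_num) (fun x v hx hv => by
      have h1 := hlow v hv
      have hx2 : 1 ≤ x ^ 2 := one_le_pow₀ hx
      calc h (x * v) ≤ min 1 ((x * v) ^ 2) := hup _ (by positivity)
        _ ≤ x ^ 2 * min 1 (v ^ 2) := by
            rw [mul_min_of_nonneg _ _ (by positivity), mul_one, mul_pow]
            exact min_le_min hx2 le_rfl
        _ ≤ x ^ 2 * (5 * h v) := by gcongr
        _ = _ := by ring)
  -- As `h` lies between `(1 ∧ v²) / 5` and `1 ∧ v²`, the two outer parts with `δ = 1/20`, `M = 20`
  -- carry at most the fractions `5 δ² δ⁻¹` and `5 M⁻¹` of the transform: one half in total.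
  obtain ⟨c, hc0, hc⟩ := le_radialLevyDensity d (h := h) (a := 0)
    (δ := 1 / 20) (M := 20) (K₁ := 5 * (1 / 20) ^ 2) (K₂ := 5) (x := 20)
    (y := 1 / 20) hm hν hfin hmeas hn hh le_rfl (by norm_num) (by norm_num) (by norm_num)
    (by norm_num) (by norm_num) (by norm_num) (by norm_num)
    (fun v hv hvδ => by
      have h1 := (hup v hv).trans (min_le_right _ _)
      have h2 := hlow (20 * v) (by positivity)
      rw [min_eq_right (by nlinarith)] at h2
      nlinarith)
    (fun v hv => by
      have h1 := (hup v (by linarith)).trans (min_le_left _ _)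
      have h2 := hlow (1 / 20 * v) (by linarith)
      rw [min_eq_left (by nlinarith)] at h2
      linarith)
    hRV1 (by norm_num)
  refine ComparableAtZero.of_bounds hc0 hC0 (fun r hr => ?_) ?_ (fun r hr => ?_)
  · rw [← heq r hr]
    exact mul_pos (Real.rpow_pos_of_pos hr _) (hRV1.1 _ (by positivity))
  · filter_upwards [hc, self_mem_nhdsWithin] with r h1 hr
    rwa [heq r hr] at h1
  · rw [← heq r hr]; exact hC r hr

end Comparison

/-! ### Spatial integrals of the heat kernel -/

section HeatKernelSpace

variable {d : ℕ}

lemma cexp_heatKernel_eq {t : ℝ} (ξ x : EuclideanSpace ℝ (Fin d)) :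
    ((heatKernel d t ‖x‖ : ℝ) : ℂ) * Complex.exp (Complex.I * ((⟪ξ, x⟫ : ℝ) : ℂ))
      = (((4 * Real.pi * t) ^ (-((d : ℝ) / 2)) : ℝ) : ℂ) *
        Complex.exp (-((1 / (4 * t) : ℝ) : ℂ) * (‖x‖ : ℂ) ^ 2
          + Complex.I * ((⟪ξ, x⟫ : ℝ) : ℂ)) := by
  have h : -(‖x‖ ^ 2) / (4 * t) = -(1 / (4 * t)) * ‖x‖ ^ 2 := by ring
  rw [heatKernel, h, Complex.exp_add]
  push_cast
  ring

lemma integrable_heatKernel_norm {t : ℝ} (ht : 0 < t) :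
    Integrable (fun x : EuclideanSpace ℝ (Fin d) => heatKernel d t ‖x‖) := by
  have hb : 0 < (((1 / (4 * t) : ℝ) : ℂ)).re := by
    rw [Complex.ofReal_re]; positivity
  have h := ((GaussianFourier.integrable_cexp_neg_mul_sq_norm_add hb Complex.I
    (0 : EuclideanSpace ℝ (Fin d))).const_mul
      (((4 * Real.pi * t) ^ (-((d : ℝ) / 2)) : ℝ) : ℂ)).re
  refine h.congr (Eventually.of_forall fun x => ?_)
  simp only
  rw [← cexp_heatKernel_eq (t := t) 0 x]
  simp

/-- The characteristic function of the Gaussian law with density the heat kernel. -/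
lemma integral_heatKernel_mul_cexp {t : ℝ} (ht : 0 < t) (ξ : EuclideanSpace ℝ (Fin d)) :
    ∫ x : EuclideanSpace ℝ (Fin d),
        ((heatKernel d t ‖x‖ : ℝ) : ℂ) * Complex.exp (Complex.I * ((⟪ξ, x⟫ : ℝ) : ℂ))
      = Complex.exp (-(t : ℂ) * (‖ξ‖ : ℂ) ^ 2) := by
  have hb : 0 < (((1 / (4 * t) : ℝ) : ℂ)).re := by
    rw [Complex.ofReal_re]; positivity
  have h4 : (0 : ℝ) < 4 * Real.pi * t := by positivity
  simp only [cexp_heatKernel_eq]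
  rw [integral_const_mul, GaussianFourier.integral_cexp_neg_mul_sq_norm_add hb Complex.I ξ]
  have e1 : ((Real.pi : ℂ) / ((1 / (4 * t) : ℝ) : ℂ)) ^ ((Module.finrank ℝ
      (EuclideanSpace ℝ (Fin d)) : ℂ) / 2) = (((4 * Real.pi * t) ^ ((d : ℝ) / 2) : ℝ) : ℂ) := by
    rw [Complex.ofReal_cpow h4.le, finrank_euclideanSpace_fin]
    have : (t : ℂ) ≠ 0 := by exact_mod_cast ht.ne'
    congr 1
    · push_cast; field_simp
    · push_cast; rfl
  have e2 : Complex.I ^ 2 * (‖ξ‖ : ℂ) ^ 2 / (4 * ((1 / (4 * t) : ℝ) : ℂ))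
      = -(t : ℂ) * (‖ξ‖ : ℂ) ^ 2 := by
    have : (t : ℂ) ≠ 0 := by exact_mod_cast ht.ne'
    rw [Complex.I_sq]; push_cast; field_simp
  rw [e1, e2, ← mul_assoc, ← Complex.ofReal_mul, ← Real.rpow_add h4, neg_add_cancel,
    Real.rpow_zero, Complex.ofReal_one, one_mul]

lemma integral_heatKernel_norm {t : ℝ} (ht : 0 < t) :
    ∫ x : EuclideanSpace ℝ (Fin d), heatKernel d t ‖x‖ = 1 := by
  have h := integral_heatKernel_mul_cexp ht (0 : EuclideanSpace ℝ (Fin d))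
  simp only [inner_zero_left, Complex.ofReal_zero, mul_zero, Complex.exp_zero, mul_one,
    norm_zero, ne_eq, OfNat.ofNat_ne_zero, not_false_eq_true, zero_pow] at h
  rw [integral_complex_ofReal] at h
  exact_mod_cast h

lemma measurable_heatKernel_norm :
    Measurable (fun p : ℝ × EuclideanSpace ℝ (Fin d) => heatKernel d p.1 ‖p.2‖) :=
  (measurable_heatKernel d).comp (measurable_fst.prodMk measurable_snd.norm)

lemma integrable_heatKernel_smul {E : Type*} [NormedAddCommGroup E] [NormedSpace ℝ E]
    {t : ℝ} (ht : 0 < t) {F : EuclideanSpace ℝ (Fin d) → E} (hF : StronglyMeasurable F) {C : ℝ}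
    (hC : ∀ x, ‖F x‖ ≤ C) : Integrable (fun x => heatKernel d t ‖x‖ • F x) := by
  refine ((integrable_heatKernel_norm (d := d) ht).mul_const C).mono'
    ((integrable_heatKernel_norm ht).aestronglyMeasurable.smul hF.aestronglyMeasurable)
    (Eventually.of_forall fun x => ?_)
  have hk := heatKernel_nonneg d ht ‖x‖
  rw [norm_smul, Real.norm_of_nonneg hk]
  exact mul_le_mul_of_nonneg_left (hC x) hk

/-- The factor `|x|²` costs a factor `t` and a doubling of the time. -/
lemma sq_norm_mul_heatKernel_le {t : ℝ} (ht : 0 < t) (r : ℝ) :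
    r ^ 2 * heatKernel d t r ≤ 8 * 2 ^ ((d : ℝ) / 2) * t * heatKernel d (2 * t) r := by
  have h1 : r ^ 2 / (8 * t) ≤ Real.exp (r ^ 2 / (8 * t)) := by
    linarith [Real.add_one_le_exp (r ^ 2 / (8 * t))]
  have h2 : r ^ 2 ≤ 8 * t * Real.exp (r ^ 2 / (8 * t)) := by
    rw [div_le_iff₀ (by positivity)] at h1; linarith
  have h3 : Real.exp (r ^ 2 / (8 * t)) * Real.exp (-(r ^ 2) / (4 * t))
      = Real.exp (-(r ^ 2) / (4 * (2 * t))) := by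
    rw [← Real.exp_add]; congr 1; field_simp; ring
  have h4 : (4 * Real.pi * (2 * t)) ^ (-((d : ℝ) / 2))
      = (2 ^ ((d : ℝ) / 2))⁻¹ * (4 * Real.pi * t) ^ (-((d : ℝ) / 2)) := by
    rw [show 4 * Real.pi * (2 * t) = 2 * (4 * Real.pi * t) by ring,
      Real.mul_rpow (by positivity) (by positivity), Real.rpow_neg (by norm_num : (0 : ℝ) ≤ 2)]
  have h5 : (0 : ℝ) < 2 ^ ((d : ℝ) / 2) := by positivity
  unfold heatKernel
  calc r ^ 2 * ((4 * Real.pi * t) ^ (-((d : ℝ) / 2)) * Real.exp (-(r ^ 2) / (4 * t)))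
      ≤ 8 * t * Real.exp (r ^ 2 / (8 * t)) *
          ((4 * Real.pi * t) ^ (-((d : ℝ) / 2)) * Real.exp (-(r ^ 2) / (4 * t))) := by gcongr
    _ = 8 * t * ((4 * Real.pi * t) ^ (-((d : ℝ) / 2)) *
          (Real.exp (r ^ 2 / (8 * t)) * Real.exp (-(r ^ 2) / (4 * t)))) := by ring
    _ = _ := by rw [h3, h4]; field_simp

lemma integral_min_mul_heatKernel_le {t : ℝ} (ht : 0 < t) :
    ∫ x : EuclideanSpace ℝ (Fin d), heatKernel d t ‖x‖ * min 1 (‖x‖ ^ 2)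
      ≤ max 1 (8 * 2 ^ ((d : ℝ) / 2)) * min 1 t := by
  have hi : Integrable (fun x : EuclideanSpace ℝ (Fin d) =>
      heatKernel d t ‖x‖ * min 1 (‖x‖ ^ 2)) :=
    integrable_heatKernel_smul ht (F := fun x => min 1 (‖x‖ ^ 2))
      (by fun_prop : Continuous _).stronglyMeasurable (C := 1) (fun x => by
        rw [Real.norm_of_nonneg (by positivity)]; exact min_le_left _ _)
  have h1 : ∫ x : EuclideanSpace ℝ (Fin d), heatKernel d t ‖x‖ * min 1 (‖x‖ ^ 2) ≤ 1 := by
    refine le_trans ?_ (integral_heatKernel_norm (d := d) ht).le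
    refine integral_mono hi (integrable_heatKernel_norm ht) fun x => ?_
    exact mul_le_of_le_one_right (heatKernel_nonneg d ht _) (min_le_left _ _)
  have h2 : ∫ x : EuclideanSpace ℝ (Fin d), heatKernel d t ‖x‖ * min 1 (‖x‖ ^ 2)
      ≤ 8 * 2 ^ ((d : ℝ) / 2) * t := by
    have ht2 : 0 < 2 * t := by positivity
    calc _ ≤ ∫ x : EuclideanSpace ℝ (Fin d),
          8 * 2 ^ ((d : ℝ) / 2) * t * heatKernel d (2 * t) ‖x‖ := by
          refine integral_mono hi ((integrable_heatKernel_norm ht2).const_mul _) fun x => ?_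
          refine le_trans ?_ (sq_norm_mul_heatKernel_le ht ‖x‖)
          rw [mul_comm]
          exact mul_le_mul_of_nonneg_right (min_le_right _ _) (heatKernel_nonneg d ht _)
      _ = _ := by rw [integral_const_mul, integral_heatKernel_norm ht2, mul_one]
  rw [mul_min_of_nonneg _ _ (by positivity), mul_one]
  refine le_min (h1.trans (le_max_left _ _)) (h2.trans ?_)
  gcongr
  exact le_max_right _ _

end HeatKernelSpace

/-! ### Integration against the radial measure -/

section RadialMeasure

variable {d : ℕ} {ν : Measure ℝ} {E : Type*} [NormedAddCommGroup E] [NormedSpace ℝ E]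

lemma integrable_heatKernel_smul_prod [SFinite ν] (h0 : ν (Iic 0) = 0)
    (hfin : ∫⁻ u, ENNReal.ofReal (min 1 u) ∂ν < ∞) {F : EuclideanSpace ℝ (Fin d) → E}
    (hF : StronglyMeasurable F) {C : ℝ} (hC0 : 0 ≤ C) (hC : ∀ x, ‖F x‖ ≤ C * min 1 (‖x‖ ^ 2)) :
    Integrable (Function.uncurry fun (t : ℝ) x => heatKernel d t ‖x‖ • F x)
      (ν.prod volume) := by
  have hpos := ae_pos_of_measure_Iic_zero h0
  have hmeas : StronglyMeasurable
      (Function.uncurry fun (t : ℝ) (x : EuclideanSpace ℝ (Fin d)) => heatKernel d t ‖x‖ • F x) :=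
    measurable_heatKernel_norm.stronglyMeasurable.smul (hF.comp_measurable measurable_snd)
  have hbdd : ∀ x, ‖F x‖ ≤ C := fun x =>
    (hC x).trans (mul_le_of_le_one_right hC0 (min_le_left _ _))
  rw [integrable_prod_iff hmeas.aestronglyMeasurable]
  refine ⟨?_, integrable_of_norm_le_min (C := C * max 1 (8 * 2 ^ ((d : ℝ) / 2))) h0 hfin
    hmeas.norm.integral_prod_right'.aestronglyMeasurable fun t ht => ?_⟩
  · filter_upwards [hpos] with t ht using integrable_heatKernel_smul ht hF hbdd
  · rw [Real.norm_of_nonneg (integral_nonneg fun _ => norm_nonneg _), mul_assoc]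
    refine le_trans ?_ (mul_le_mul_of_nonneg_left (integral_min_mul_heatKernel_le ht) hC0)
    rw [← integral_const_mul]
    refine integral_mono (integrable_heatKernel_smul ht hF hbdd).norm
      (Integrable.const_mul ?_ C) fun x => ?_
    · exact integrable_heatKernel_smul ht (F := fun x => min 1 (‖x‖ ^ 2))
        (by fun_prop : Continuous _).stronglyMeasurable (C := 1) (fun x => by
          rw [Real.norm_of_nonneg (by positivity)]; exact min_le_left _ _)
    · have hk := heatKernel_nonneg d ht ‖x‖
      simp only [Function.uncurry_apply_pair, norm_smul, Real.norm_of_nonneg hk]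
      calc heatKernel d t ‖x‖ * ‖F x‖ ≤ heatKernel d t ‖x‖ * (C * min 1 (‖x‖ ^ 2)) := by
            gcongr; exact hC x
        _ = _ := by ring

lemma radialLevyDensity_nonneg (h0 : ν (Iic 0) = 0) (r : ℝ) :
    0 ≤ radialLevyDensity d ν r := by
  rw [radialLevyDensity_eq_integral h0]
  refine integral_nonneg_of_ae ?_
  filter_upwards [ae_pos_of_measure_Iic_zero h0] with t ht using heatKernel_nonneg d ht r

lemma measurable_radialLevyDensity [SFinite ν] (h0 : ν (Iic 0) = 0) :
    Measurable (radialLevyDensity d ν) := by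
  have h := ((measurable_heatKernel d).comp
    measurable_swap).stronglyMeasurable.integral_prod_right' (ν := ν)
  have e : radialLevyDensity d ν = fun r => ∫ t, heatKernel d t r ∂ν :=
    funext (radialLevyDensity_eq_integral h0 d)
  rw [e]
  exact h.measurable

lemma radialLevyDensity_smul (h0 : ν (Iic 0) = 0) [CompleteSpace E] (r : ℝ) (v : E) :
    ∫ t, heatKernel d t r • v ∂ν = (ENNReal.ofReal (radialLevyDensity d ν r)).toReal • v := by
  rw [ENNReal.toReal_ofReal (radialLevyDensity_nonneg h0 r), radialLevyDensity_eq_integral h0,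
    integral_smul_const]

lemma measurable_ofReal_radialLevyDensity_norm [SFinite ν] (h0 : ν (Iic 0) = 0) :
    Measurable fun x : EuclideanSpace ℝ (Fin d) =>
      ENNReal.ofReal (radialLevyDensity d ν ‖x‖) :=
  ((measurable_radialLevyDensity h0).comp measurable_norm).ennreal_ofReal

lemma integrable_radialMeasure [SFinite ν] [CompleteSpace E] (h0 : ν (Iic 0) = 0)
    (hfin : ∫⁻ u, ENNReal.ofReal (min 1 u) ∂ν < ∞) {F : EuclideanSpace ℝ (Fin d) → E}
    (hF : StronglyMeasurable F) {C : ℝ} (hC0 : 0 ≤ C) (hC : ∀ x, ‖F x‖ ≤ C * min 1 (‖x‖ ^ 2)) :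
    Integrable F (radialMeasure d (radialLevyDensity d ν)) := by
  have h := (integrable_heatKernel_smul_prod h0 hfin hF hC0 hC).integral_prod_right
  rw [radialMeasure, integrable_withDensity_iff_integrable_smul'
    (measurable_ofReal_radialLevyDensity_norm h0)
    (Eventually.of_forall fun _ => ENNReal.ofReal_lt_top)]
  exact h.congr (Eventually.of_forall fun x => radialLevyDensity_smul h0 ‖x‖ (F x))

/-- Fubini for the measure `j(|x|) dx`, a mixture of Gaussian laws. -/
lemma integral_radialMeasure [SFinite ν] [CompleteSpace E] (h0 : ν (Iic 0) = 0)
    (hfin : ∫⁻ u, ENNReal.ofReal (min 1 u) ∂ν < ∞) {F : EuclideanSpace ℝ (Fin d) → E}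
    (hF : StronglyMeasurable F) {C : ℝ} (hC0 : 0 ≤ C) (hC : ∀ x, ‖F x‖ ≤ C * min 1 (‖x‖ ^ 2)) :
    ∫ x, F x ∂(radialMeasure d (radialLevyDensity d ν))
      = ∫ t, (∫ x : EuclideanSpace ℝ (Fin d), heatKernel d t ‖x‖ • F x) ∂ν := by
  rw [radialMeasure, integral_withDensity_eq_integral_toReal_smul
    (measurable_ofReal_radialLevyDensity_norm h0)
    (Eventually.of_forall fun _ => ENNReal.ofReal_lt_top),
    integral_integral_swap (integrable_heatKernel_smul_prod h0 hfin hF hC0 hC)]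
  exact integral_congr_ae (Eventually.of_forall fun x =>
    (radialLevyDensity_smul h0 ‖x‖ (F x)).symm)

/-- The compensated integrand of the Lévy–Khintchine formula is `O(1 ∧ |x|²)`. -/
lemma norm_levyKhintchine_integrand_le (ξ x : EuclideanSpace ℝ (Fin d)) :
    ‖1 - Complex.exp (Complex.I * ((⟪x, ξ⟫ : ℝ) : ℂ)) +
        (if ‖x‖ ≤ 1 then Complex.I * ((⟪x, ξ⟫ : ℝ) : ℂ) else 0)‖
      ≤ (2 + 3 * ‖ξ‖ ^ 2) * min 1 (‖x‖ ^ 2) := by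
  set y : ℝ := ⟪x, ξ⟫ with hy
  have hexp : ‖Complex.exp (Complex.I * (y : ℂ))‖ = 1 := by
    rw [mul_comm]; exact Complex.norm_exp_ofReal_mul_I y
  have hy1 : |y| ≤ ‖x‖ * ‖ξ‖ := abs_real_inner_le_norm x ξ
  have htwo : ‖1 - Complex.exp (Complex.I * (y : ℂ))‖ ≤ 2 := by
    refine (norm_sub_le _ _).trans ?_
    rw [hexp]; norm_num
  have hIy : ‖Complex.I * (y : ℂ)‖ = |y| := by simp
  split_ifs with hx
  · rw [min_eq_right (by nlinarith [norm_nonneg x])]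
    have h3 : ‖1 - Complex.exp (Complex.I * (y : ℂ)) + Complex.I * (y : ℂ)‖ ≤ 3 * y ^ 2 := by
      rcases le_total |y| 1 with h | h
      · have h4 := Complex.norm_exp_sub_one_sub_id_le (x := Complex.I * (y : ℂ)) (by rwa [hIy])
        rw [hIy, sq_abs] at h4
        rw [← norm_neg]
        refine le_trans (le_of_eq ?_) (h4.trans (by nlinarith [sq_nonneg y]))
        congr 1; ring
      · refine (norm_add_le _ _).trans ?_
        rw [hIy]
        have : |y| ^ 2 = y ^ 2 := sq_abs y
        nlinarith
    have h5 : y ^ 2 ≤ (‖x‖ * ‖ξ‖) ^ 2 := by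
      rw [← sq_abs]; gcongr
    rw [mul_pow] at h5
    nlinarith [sq_nonneg ‖x‖]
  · rw [min_eq_left (by nlinarith), add_zero, mul_one]
    nlinarith [sq_nonneg ‖ξ‖]

lemma integral_heatKernel_levyKhintchine {t : ℝ} (ht : 0 < t) (ξ : EuclideanSpace ℝ (Fin d)) :
    ∫ x : EuclideanSpace ℝ (Fin d), heatKernel d t ‖x‖ •
        (1 - Complex.exp (Complex.I * ((⟪x, ξ⟫ : ℝ) : ℂ)) +
          (if ‖x‖ ≤ 1 then Complex.I * ((⟪x, ξ⟫ : ℝ) : ℂ) else 0))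
      = ((1 - Real.exp (-(‖ξ‖ ^ 2 * t)) : ℝ) : ℂ) := by
  have i1 : Integrable (fun x : EuclideanSpace ℝ (Fin d) => heatKernel d t ‖x‖ • (1 : ℂ)) :=
    integrable_heatKernel_smul ht stronglyMeasurable_const (C := 1) (fun x => by simp)
  have i2 : Integrable (fun x : EuclideanSpace ℝ (Fin d) => heatKernel d t ‖x‖ •
      Complex.exp (Complex.I * ((⟪x, ξ⟫ : ℝ) : ℂ))) :=
    integrable_heatKernel_smul ht (by fun_prop : Continuous _).stronglyMeasurable (C := 1)
      (fun x => by rw [mul_comm, Complex.norm_exp_ofReal_mul_I])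
  have i3 : Integrable (fun x : EuclideanSpace ℝ (Fin d) => heatKernel d t ‖x‖ •
      (if ‖x‖ ≤ 1 then Complex.I * ((⟪x, ξ⟫ : ℝ) : ℂ) else 0)) := by
    refine integrable_heatKernel_smul ht (StronglyMeasurable.ite
      (measurableSet_le measurable_norm measurable_const)
      (by fun_prop : Continuous _).stronglyMeasurable stronglyMeasurable_const) (C := ‖ξ‖)
      (fun x => ?_)
    split_ifs with hx
    · rw [norm_mul, Complex.norm_I, one_mul, Complex.norm_real]
      exact (norm_inner_le_norm x ξ).trans (mul_le_of_le_one_left (norm_nonneg _) hx)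
    · simp
  -- The compensator is odd.
  have e3 : ∫ x : EuclideanSpace ℝ (Fin d), heatKernel d t ‖x‖ •
      (if ‖x‖ ≤ 1 then Complex.I * ((⟪x, ξ⟫ : ℝ) : ℂ) else 0) = 0 := by
    have h := integral_neg_eq_self (fun x : EuclideanSpace ℝ (Fin d) => heatKernel d t ‖x‖ •
      (if ‖x‖ ≤ 1 then Complex.I * ((⟪x, ξ⟫ : ℝ) : ℂ) else 0)) volume
    rw [← self_eq_neg, ← integral_neg]
    rw [← h]
    refine integral_congr_ae (Eventually.of_forall fun x => ?_)
    simp only [norm_neg, inner_neg_left]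
    split_ifs <;> simp
  have e2 := integral_heatKernel_mul_cexp ht ξ
  have e1 : ∫ x : EuclideanSpace ℝ (Fin d), heatKernel d t ‖x‖ • (1 : ℂ) = 1 := by
    rw [integral_smul_const, integral_heatKernel_norm ht, one_smul]
  simp only [smul_add, smul_sub]
  have i12 : Integrable (fun x : EuclideanSpace ℝ (Fin d) => heatKernel d t ‖x‖ • (1 : ℂ) -
      heatKernel d t ‖x‖ • Complex.exp (Complex.I * ((⟪x, ξ⟫ : ℝ) : ℂ))) := i1.sub i2
  rw [integral_add i12 i3, e3, add_zero, integral_sub i1 i2, e1]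
  simp only [Complex.real_smul]
  simp only [real_inner_comm ξ]  at e2 ⊢
  rw [e2]
  push_cast
  congr 2
  ring

/-- The Lévy–Khintchine integral of `j(|x|) dx` is the jump part of `φ(|ξ|²)`. -/
lemma integral_levyKhintchine_radialMeasure [SFinite ν] (h0 : ν (Iic 0) = 0)
    (hfin : ∫⁻ u, ENNReal.ofReal (min 1 u) ∂ν < ∞) (ξ : EuclideanSpace ℝ (Fin d)) :
    ∫ x, (1 - Complex.exp (Complex.I * ((⟪x, ξ⟫ : ℝ) : ℂ)) +
          (if ‖x‖ ≤ 1 then Complex.I * ((⟪x, ξ⟫ : ℝ) : ℂ) else 0))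
        ∂(radialMeasure d (radialLevyDensity d ν))
      = ((∫ t, (1 - Real.exp (-(‖ξ‖ ^ 2 * t))) ∂ν : ℝ) : ℂ) := by
  rw [integral_radialMeasure (E := ℂ) h0 hfin ?_ (by positivity : 0 ≤ 2 + 3 * ‖ξ‖ ^ 2)
    (norm_levyKhintchine_integrand_le ξ),
    ← integral_complex_ofReal]
  · refine integral_congr_ae ?_
    filter_upwards [ae_pos_of_measure_Iic_zero h0] with t ht
      using integral_heatKernel_levyKhintchine ht ξ
  · exact (by fun_prop : Continuous fun x : EuclideanSpace ℝ (Fin d) =>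
      1 - Complex.exp (Complex.I * ((⟪x, ξ⟫ : ℝ) : ℂ))).stronglyMeasurable.add
      (StronglyMeasurable.ite (measurableSet_le measurable_norm measurable_const)
        (by fun_prop : Continuous _).stronglyMeasurable stronglyMeasurable_const)

end RadialMeasure

/-! ### The characteristic function of subordinate Brownian motion -/

section Subordination

variable {Ω : Type*} [MeasurableSpace Ω] {P : Measure Ω} [IsProbabilityMeasure P] {d : ℕ}
  {S : ℝ≥0 → Ω → ℝ} {B : ℝ≥0 → Ω → EuclideanSpace ℝ (Fin d)}

lemma IsBrownianMotion.integral_cexp_inner (hB : IsBrownianMotion B P) (t : ℝ≥0)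
    (ξ : EuclideanSpace ℝ (Fin d)) :
    ∫ ω, Complex.exp (Complex.I * ((⟪ξ, B t ω⟫ : ℝ) : ℂ)) ∂P
      = Complex.exp (-((t : ℝ) : ℂ) * (‖ξ‖ : ℂ) ^ 2) := by
  rcases eq_zero_or_pos t with rfl | ht
  · have h : ∀ᵐ ω ∂P, Complex.exp (Complex.I * ((⟪ξ, B 0 ω⟫ : ℝ) : ℂ)) = 1 := by
      filter_upwards [hB.zero] with ω hω
      simp [hω]
    rw [integral_congr_ae h]
    simp
  · have hcont : Continuous fun x : EuclideanSpace ℝ (Fin d) =>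
        Complex.exp (Complex.I * ((⟪ξ, x⟫ : ℝ) : ℂ)) := by fun_prop
    rw [← integral_map (hB.measurable t).aemeasurable hcont.aestronglyMeasurable, hB.law t ht,
      integral_withDensity_eq_integral_toReal_smul _
        (Eventually.of_forall fun _ => ENNReal.ofReal_lt_top),
      ← integral_heatKernel_mul_cexp (NNReal.coe_pos.2 ht) ξ]
    · refine integral_congr_ae (Eventually.of_forall fun x => ?_)
      simp only
      rw [ENNReal.toReal_ofReal (heatKernel_nonneg d (NNReal.coe_pos.2 ht) _), Complex.real_smul]
    · exact ((measurable_heatKernel d).comp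
        (measurable_const.prodMk measurable_norm)).ennreal_ofReal

/-- Conditioning on the independent time change: for a random time with values in a grid. -/
lemma integral_cexp_inner_grid (hB : IsBrownianMotion B P)
    {N : Ω → ℕ} (hN : Measurable N) (hBN : IndepFun (fun ω t => B t ω) N P) (n : ℕ)
    (ξ : EuclideanSpace ℝ (Fin d)) :
    ∫ ω, Complex.exp (Complex.I * ((⟪ξ, B ((N ω : ℝ≥0) / n) ω⟫ : ℝ) : ℂ)) ∂P
      = ∫ ω, Complex.exp (-(((N ω : ℝ) / n : ℝ) : ℂ) * (‖ξ‖ : ℂ) ^ 2) ∂P := by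
  have hBm : Measurable (fun ω t => B t ω) := measurable_pi_iff.2 hB.measurable
  set g : (ℝ≥0 → EuclideanSpace ℝ (Fin d)) × ℕ → ℂ := fun p =>
    Complex.exp (Complex.I * ((⟪ξ, p.1 ((p.2 : ℝ≥0) / n)⟫ : ℝ) : ℂ)) with hg
  have hcont : Continuous fun x : EuclideanSpace ℝ (Fin d) =>
        Complex.exp (Complex.I * ((⟪ξ, x⟫ : ℝ) : ℂ)) := by fun_prop
  have hgm : Measurable g := measurable_from_prod_countable_left fun k =>
    hcont.measurable.comp (measurable_pi_apply ((k : ℝ≥0) / n))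
  have : IsProbabilityMeasure (P.map (fun ω t => B t ω)) :=
    Measure.isProbabilityMeasure_map hBm.aemeasurable
  have : IsProbabilityMeasure (P.map N) := Measure.isProbabilityMeasure_map hN.aemeasurable
  have hgi : Integrable g ((P.map (fun ω t => B t ω)).prod (P.map N)) :=
    Integrable.of_bound hgm.aestronglyMeasurable 1 (Eventually.of_forall fun p => by
      rw [hg]; simp only; rw [mul_comm, Complex.norm_exp_ofReal_mul_I])
  have h1 : ∫ ω, g ((fun t => B t ω), N ω) ∂P
      = ∫ p, g p ∂((P.map (fun ω t => B t ω)).prod (P.map N)) := by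
    rw [← (indepFun_iff_map_prod_eq_prod_map_map hBm.aemeasurable hN.aemeasurable).1 hBN,
      integral_map (hBm.prodMk hN).aemeasurable hgm.aestronglyMeasurable]
  have h2 : ∀ k : ℕ, ∫ b, g (b, k) ∂(P.map (fun ω t => B t ω))
      = Complex.exp (-(((k : ℝ) / n : ℝ) : ℂ) * (‖ξ‖ : ℂ) ^ 2) := by
    intro k
    rw [integral_map hBm.aemeasurable
      (show Measurable fun b => g (b, k) from
        hgm.comp measurable_prodMk_right).aestronglyMeasurable]
    have := hB.integral_cexp_inner ((k : ℝ≥0) / n) ξ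
    simpa [hg] using this
  change ∫ ω, g ((fun t => B t ω), N ω) ∂P = _
  rw [h1, integral_prod_symm _ hgi]
  simp only [h2]
  rw [integral_map hN.aemeasurable (measurable_of_countable _).aestronglyMeasurable]

/-- The subordination identity `E[exp(i⟨ξ, B(Sₜ)⟩)] = E[exp(-|ξ|² Sₜ)]`, by approximating `Sₜ` by
random times with values in a grid. -/
lemma integral_cexp_inner_subordinate (hS : IsSubordinator S P) (hB : IsBrownianMotion B P)
    (hBS : IndepFun (fun ω t => B t ω) (fun ω t => S t ω) P) (t : ℝ≥0)
    (ξ : EuclideanSpace ℝ (Fin d)) :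
    ∫ ω, Complex.exp (Complex.I * ((⟪ξ, subordinate B S t ω⟫ : ℝ) : ℂ)) ∂P
      = ((∫ ω, Real.exp (-(‖ξ‖ ^ 2) * S t ω) ∂P : ℝ) : ℂ) := by
  -- The grid times `⌊n Sₜ⌋ / n`; the value at `n = 0`, a division by zero, is irrelevant.
  set N : ℕ → Ω → ℕ := fun n ω => ⌊S t ω * n⌋₊ with hNdef
  have hN : ∀ n, Measurable (N n) := fun n =>
    ((hS.measurable t).mul_const _).nat_floor
  have hBN : ∀ n, IndepFun (fun ω t => B t ω) (N n) P := fun n =>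
    hBS.comp measurable_id
      (by fun_prop : Measurable fun s : ℝ≥0 → ℝ => ⌊s t * n⌋₊)
  have hfloor : ∀ ω, 0 ≤ S t ω →
      Tendsto (fun n : ℕ => ((N n ω : ℝ) / n : ℝ)) atTop (𝓝 (S t ω)) := fun ω hω =>
    (tendsto_nat_floor_mul_div_atTop hω).comp tendsto_natCast_atTop_atTop
  have hBmeas : ∀ n, Measurable fun ω => B ((N n ω : ℝ≥0) / n) ω := fun n => by
    have h1 : Measurable fun p : (ℝ≥0 → EuclideanSpace ℝ (Fin d)) × ℕ =>
        p.1 ((p.2 : ℝ≥0) / n) :=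
      measurable_from_prod_countable_left fun k => measurable_pi_apply ((k : ℝ≥0) / n)
    exact h1.comp ((measurable_pi_iff.2 hB.measurable).prodMk (hN n))
  have hcont : Continuous fun x : EuclideanSpace ℝ (Fin d) =>
        Complex.exp (Complex.I * ((⟪ξ, x⟫ : ℝ) : ℂ)) := by fun_prop
  have lim1 : Tendsto (fun n => ∫ ω,
      Complex.exp (Complex.I * ((⟪ξ, B ((N n ω : ℝ≥0) / n) ω⟫ : ℝ) : ℂ)) ∂P) atTop
      (𝓝 (∫ ω, Complex.exp (Complex.I * ((⟪ξ, subordinate B S t ω⟫ : ℝ) : ℂ)) ∂P)) := by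
    refine tendsto_integral_of_dominated_convergence (fun _ => 1)
      (fun n => (hcont.measurable.comp (hBmeas n)).aestronglyMeasurable) (integrable_const _)
      (fun n => Eventually.of_forall fun ω => ?_) ?_
    · rw [mul_comm, Complex.norm_exp_ofReal_mul_I]
    · filter_upwards [hS.nonneg t, hB.continuous_paths] with ω hω hc
      refine (hcont.tendsto _).comp ((hc.tendsto _).comp ?_)
      rw [← NNReal.tendsto_coe, Real.coe_toNNReal _ hω]
      simpa using hfloor ω hω
  have lim2 : Tendsto (fun n : ℕ => ∫ ω,
      Complex.exp (-(((N n ω : ℝ) / n : ℝ) : ℂ) * (‖ξ‖ : ℂ) ^ 2) ∂P) atTop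
      (𝓝 (∫ ω, Complex.exp (-((S t ω : ℝ) : ℂ) * (‖ξ‖ : ℂ) ^ 2) ∂P)) := by
    have hcont2 : Continuous fun s : ℝ => Complex.exp (-(s : ℂ) * (‖ξ‖ : ℂ) ^ 2) := by fun_prop
    refine tendsto_integral_of_dominated_convergence (fun _ => 1)
      (fun n => (hcont2.measurable.comp
        (((measurable_from_nat (f := fun k : ℕ => (k : ℝ))).comp (hN n)).div_const
          _)).aestronglyMeasurable)
      (integrable_const _) (fun n => Eventually.of_forall fun ω => ?_) ?_
    · rw [Complex.norm_exp, ← Complex.ofReal_neg, ← Complex.ofReal_pow, ← Complex.ofReal_mul,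
        Complex.ofReal_re, Real.exp_le_one_iff]
      have : (0 : ℝ) ≤ (N n ω : ℝ) / n * ‖ξ‖ ^ 2 := by positivity
      linarith
    · filter_upwards [hS.nonneg t] with ω hω
      exact (hcont2.tendsto _).comp (hfloor ω hω)
  have heq := tendsto_nhds_unique (lim1.congr fun n =>
    integral_cexp_inner_grid hB (hN n) (hBN n) n ξ) lim2
  rw [heq, ← integral_complex_ofReal]
  refine integral_congr_ae (Eventually.of_forall fun ω => ?_)
  simp only
  push_cast
  congr 1
  ring

lemma isLevyMeasureOf_subordinate (hd : 0 < d) (hS : IsSubordinator S P)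
    (hB : IsBrownianMotion B P)
    (hBS : IndepFun (fun ω t => B t ω) (fun ω t => S t ω) P) {ν : Measure ℝ} [SFinite ν]
    (hν : IsSubordinatorLevyMeasure S P ν) :
    IsLevyMeasureOf (subordinate B S) P (radialMeasure d (radialLevyDensity d ν)) := by
  obtain ⟨h0, hfin, γ, hγ, hrep⟩ := hν
  have : Nonempty (Fin d) := ⟨⟨0, hd⟩⟩
  refine ⟨?_, ?_, 0, (2 * γ) • ContinuousLinearMap.id ℝ _, ?_, fun t ξ => ?_⟩
  · exact withDensity_absolutelyContinuous _ _ (measure_singleton 0)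
  · have h := integrable_radialMeasure (d := d) h0 hfin (F := fun x => min 1 (‖x‖ ^ 2))
      (by fun_prop : Continuous _).stronglyMeasurable zero_le_one (fun x => by
        rw [Real.norm_of_nonneg (by positivity), one_mul])
    have h2 := h.2
    rw [hasFiniteIntegral_iff_ofReal (Eventually.of_forall fun x => by
      simp only [Pi.zero_apply]; positivity)] at h2
    exact h2
  · exact ContinuousLinearMap.isPositive_one.smul_of_nonneg (by positivity)
  · rw [integral_cexp_inner_subordinate hS hB hBS t ξ,
      integral_levyKhintchine_radialMeasure h0 hfin ξ]
    have hL : ∫ ω, Real.exp (-(‖ξ‖ ^ 2) * S t ω) ∂P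
        = Real.exp (-(t : ℝ) * (γ * ‖ξ‖ ^ 2 + ∫ u, (1 - Real.exp (-(‖ξ‖ ^ 2 * u))) ∂ν)) := by
      rcases eq_or_ne ξ 0 with rfl | hξ
      · simp
      · have := hrep t (‖ξ‖ ^ 2) (by positivity)
        rw [restrict_Ioi_zero_eq_self h0] at this
        simpa only [neg_mul] using this
    rw [hL]
    push_cast
    congr 2
    simp [inner_smul_left]
    ring

end Subordination

theorem mainTheorem3 {Ω : Type*} [MeasurableSpace Ω] (P : Measure Ω) [IsProbabilityMeasure P]
    (d : ℕ) (hd : 3 ≤ d)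
    (S : ℝ≥0 → Ω → ℝ) (hS : IsSubordinator S P)
    (B : ℝ≥0 → Ω → EuclideanSpace ℝ (Fin d)) (hB : IsBrownianMotion B P)
    (hBS : IndepFun (fun ω t => B t ω) (fun ω t => S t ω) P)
    (ν : Measure ℝ) (hν : IsSubordinatorLevyMeasure S P ν)
    (α : ℝ) (hα : α ∈ Icc (0 : ℝ) 2)
    (hA1 : RegularlyVarying (deriv (laplaceExponent S P)) (α / 2 - 1))
    (hA2 : ν univ = ∞ ∧ HasDecreasingDensity ν) :
    IsLevyMeasureOf (subordinate B S) P (radialMeasure d (radialLevyDensity d ν)) ∧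
    (α < 2 →
      ComparableAtZero (radialLevyDensity d ν)
        (fun r => r ^ (-(d : ℝ) - 2) * deriv (laplaceExponent S P) (r ^ (-2 : ℝ)))) ∧
    (α = 2 → RegularlyVarying (deriv (fun l => l / laplaceExponent S P l)) (-1) →
      ComparableAtZero (radialLevyDensity d ν)
        (fun r => r ^ (-(d : ℝ) - 2) *
          (r ^ 2 * laplaceExponent S P (r ^ (-2 : ℝ))
            - deriv (laplaceExponent S P) (r ^ (-2 : ℝ))))) := by
  have hsf : SFinite ν := by
    obtain ⟨m, -, rfl⟩ := hA2.2
    infer_instance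
  refine ⟨isLevyMeasureOf_subordinate (by lia) hS hB hBS hν, fun hα2 => ?_, fun hα2 hA4 => ?_⟩
  · obtain ⟨-, hfin, γ, hγ, hrep⟩ := hν
    exact comparableAtZero_of_index_lt_one hd hγ hfin hrep hA2.2 (div_nonneg hα.1 two_pos.le)
      (by linarith) hA1
  · obtain ⟨-, hfin, γ, hγ, hrep⟩ := hν
    rw [hα2, div_self two_ne_zero, sub_self] at hA1
    exact comparableAtZero_of_index_one hd hγ hfin hrep hA2.1 hA2.2 hA1 hA4
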